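/- All subgroups of profinite groups are closed, normal closures $\langle S\rangle^G$ are closed normal subgroups generated by $S$, $[x,y]=x^{-1}y^{-1}xy$, and longer commutators are left-normed. For an element $x$ (respectively a closed subgroup $H$) of a profinite group, $|x|$ (respectively $|H|$) denotes its order as a supernatural number, and $\pi(H)$ is the set of primes dividing $|H|$; the order of $x$ is that of the closed subgroup it generates. Every element of a profinite group $G$ is a $\delta_0^*$-value; for $k\ge 1$ a $\delta_k^*$-value is an element $[x,y]$, where $x,y$ are powers (with exponents in $\widehat{\mathbb Z}$) of $\delta_{k-1}^*$-values and $(|x|,|y|)=1$. Write $G_{\delta_k^*}$ for the set of $\delta_k^*$-values of $G$. Let $t\ge 1$ and let $G_1,\dots,G_t$ be pronilpotent subgroups of a profinite group $G$ such that $G_j\le N_G(G_i)$ for all $j\le i$. For subsets $S_i\subseteq G_i$ put $$\varphi^*(S_1,\dots,S_t)=\{[g_1,\dots,g_t]\mid g_i\in S_i \text{ for } 1\le i\le t,\ (|g_i|,|g_{i+1}|)=1\text{ for } 1\le i<t\}.$$ For a set $\sigma$ of primes let $N_\sigma$ be the closed normal subgroup of $G$ generated by the sets $\varphi^*(G_1,\dots,G_{j-1},H_j,G_{j+1},\dots,G_t)$,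 where $j$ ranges over the indices for which $\pi(G_j)$ is infinite and $H_j$ is the Hall $\sigma$-subgroup of $G_j$ (so $N_\sigma=1$ if there is no such $j$). **Lemma.** If $|G_{\delta_{t-1}^*}|<2^{\aleph_0}$, then there exist a finite set $W\subseteq\varphi^*(G_1,\dots,G_t)$ and a finite set $\sigma$ of primes such that $$\varphi^*(G_1,\dots,G_t)\subseteq N_\sigma\,\langle W\rangle^G .$$ -/

import Mathlib

open scoped Pointwise

namespace CoprimeCommutators

universe u

/-- A topological group is pronilpotent when all its quotients by open normal subgroups are
nilpotent. It is applied to closed subgroups of profinite groups. -/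
def IsPronilpotent (P : Type u) [Group P] [TopologicalSpace P] : Prop :=
  ∀ U : OpenNormalSubgroup P, Group.IsNilpotent (P ⧸ U.toSubgroup)

variable {G : Type u} [Group G]

/-- The commutator with the convention `[x, y] = x⁻¹ y⁻¹ x y`. -/
def comm (x y : G) : G := x⁻¹ * y⁻¹ * x * y

/-- The left-normed commutator `[g₀, g₁, …, gₙ] = [[g₀, …, gₙ₋₁], gₙ]`. -/
def leftNormed : (n : ℕ) → (Fin (n + 1) → G) → G
  | 0, g => g 0
  | n + 1, g => comm (leftNormed n (Fin.init g)) (g (Fin.last (n + 1)))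

variable [TopologicalSpace G]

/-- `π(H)` for a closed subgroup `H` of a profinite group `G`: the primes dividing the supernatural
number `|H|`, the least common multiple of the indices `|H : H ∩ U|` over the open normal
subgroups `U` of `G`. (The subgroups `H ∩ U` are cofinal among the open normal subgroups of `H`.) -/
def primesOf (H : Subgroup G) : Set ℕ :=
  {p | p.Prime ∧ ∃ U : OpenNormalSubgroup G, p ∣ U.toSubgroup.relIndex H}

/-- The primes dividing the supernatural index `|H : K|` of closed subgroups `K ≤ H`, the least
common multiple of the indices `|H : H ∩ KU|` over the open normal subgroups `U` of `G`. -/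
def primesOfIndex (K H : Subgroup G) : Set ℕ :=
  {p | p.Prime ∧ ∃ U : OpenNormalSubgroup G, p ∣ (K ⊔ U.toSubgroup).relIndex H}

/-- `K` is a Hall `σ`-subgroup of `H`: a closed subgroup whose order is divisible only by primes
in `σ` and whose index is divisible only by primes outside `σ`. -/
structure IsHall (σ : Set ℕ) (K H : Subgroup G) : Prop where
  isClosed : IsClosed (K : Set G)
  le : K ≤ H
  order : primesOf K ⊆ σ
  index : Disjoint (primesOfIndex K H) σ

variable [IsTopologicalGroup G]

/-- The closed subgroup generated by `x`; in a profinite group it consists of the powers `x ^ l`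
with `l` a profinite integer. -/
def closedPowers (x : G) : Subgroup G := (Subgroup.zpowers x).topologicalClosure

/-- `(|x|, |y|) = 1`: no prime divides the supernatural orders of both `x` and `y`. -/
def CoprimeOrders (x y : G) : Prop :=
  Disjoint (primesOf (closedPowers x)) (primesOf (closedPowers y))

/-- `δ*ₖ`-values: every element is a `δ*₀`-value, and a `δ*ₖ₊₁`-value is a commutator `[x, y]`
of powers `x`, `y` of `δ*ₖ`-values having coprime orders. -/
def IsDeltaStarValue : ℕ → G → Prop
  | 0, _ => True
  | k + 1, a => ∃ b c x y : G, IsDeltaStarValue k b ∧ IsDeltaStarValue k c ∧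
      x ∈ closedPowers b ∧ y ∈ closedPowers c ∧ CoprimeOrders x y ∧ a = comm x y

/-- `φ*(S₀, …, Sₙ)`: the commutators `[g₀, …, gₙ]` with `gᵢ ∈ Sᵢ` such that any two consecutive
entries have coprime orders. -/
def phiStar {n : ℕ} (S : Fin (n + 1) → Set G) : Set G :=
  {a | ∃ g : Fin (n + 1) → G, (∀ i, g i ∈ S i) ∧
    (∀ i : Fin n, CoprimeOrders (g i.castSucc) (g i.succ)) ∧ a = leftNormed n g}

/-- The closed normal subgroup generated by a set, that is `⟨S⟩^G`. -/
def closedNormalClosure (S : Set G) : Subgroup G :=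
  (Subgroup.normalClosure S).topologicalClosure

/-- `N_σ`: the closed normal subgroup generated by all the sets `φ*(G₀, …, K, …, Gₙ)`, in which for
some `j` with `π(Gⱼ)` infinite the entry `Gⱼ` is replaced by its Hall `σ`-subgroup `K` (which is
unique when `Gⱼ` is pronilpotent). -/
def nSigma {n : ℕ} (A : Fin (n + 1) → Subgroup G) (σ : Set ℕ) : Subgroup G :=
  closedNormalClosure
    {a | ∃ (j : Fin (n + 1)) (K : Subgroup G), (primesOf (A j)).Infinite ∧ IsHall σ K (A j) ∧
      a ∈ phiStar (Function.update (fun i => (A i : Set G)) j (K : Set G))}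

end CoprimeCommutators

/-! Three facts carry the proof. First, coprime action on a pronilpotent subgroup gives `[x, h] =
[x, [x, k]]` (`exists_comm_comm_eq`), so each new entry of a coprime commutator raises the level by
one, and the elements of `φ*` are `δ*`-values (`isDeltaStarValue_seqComm`). Second, a nonempty
closed set of fewer than `2^ℵ₀` points in a profinite space has an isolated point, so the commutator
map is constant on a nonempty relatively open part of any nonempty closed set of coprime sequences
(`exists_const_on_open`). Third, `[x, hk] = [x, k] [x, h]^k` turns constancy on cosets `a i V` into
a statement about entries in `V` itself: these commutators lie in the normal closure of finitely
many values (`tailIn_finalSet`).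

The obstacle is that coprime sequences do not form a product set. Fixing sets of primes `τ i`,
consecutive ones disjoint, and taking entries in Hall `τ i`-subgroups restores a product of
subgroups. Let `I` be the set of indices with `π(G_i)` infinite. Outside `I` only finitely many
choices of `τ i` occur; inside `I` it suffices that `τ i` avoids a finite set containing the primes
of `|G : U|`, which forces these entries into `U`. `exists_normalClosure_bigSet` frees the entries
outside `I` from lying in an open subgroup, at the cost of finitely many commutators in `W`. Finally
each entry indexed by `I` splits into a `σ`-part and a `σ'`-part: commutators with a `σ`-entry lie
in `N_σ`, those with only `σ'`-entries at `I` in `⟨W⟩^G` (`seqComm_mem_of_hall`). -/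

namespace CoprimeCommutators

universe u

/-! ### Expanding left-normed commutators entry by entry -/

section Group

variable {G : Type u} [Group G]

/-- The left-normed commutator `[g 0, …, g k]` of the initial terms of a sequence. -/
def seqComm (g : ℕ → G) : ℕ → G
  | 0 => g 0
  | k + 1 => comm (seqComm g k) (g (k + 1))

lemma seqComm_congr {g h : ℕ → G} {k : ℕ} (H : ∀ i ≤ k, g i = h i) : seqComm g k = seqComm h k := by
  induction k with
  | zero => exact H 0 le_rfl
  | succ k ih => simp only [seqComm]; rw [ih fun i hi => H i (by omega), H _ le_rfl]

lemma leftNormed_eq_seqComm (n : ℕ) (g : ℕ → G) :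
    leftNormed n (fun i : Fin (n + 1) => g i) = seqComm g n := by
  induction n with
  | zero => rfl
  | succ n ih =>
    simp only [leftNormed, seqComm, Fin.val_last]
    rw [← ih]
    rfl

/-- `[x, g₁, …, gᵣ] ∈ M` for all `gᵢ ∈ S (k + i)`. -/
def TailIn (M : Subgroup G) (S : ℕ → Set G) : ℕ → ℕ → G → Prop
  | 0, _, x => x ∈ M
  | r + 1, k, x => ∀ g ∈ S (k + 1), TailIn M S r (k + 1) (comm x g)

/-- Lets one entry be varied at a time, with the earlier ones absorbed into `x`. -/
lemma tailIn_iff_seqComm (M : Subgroup G) (S : ℕ → Set G) (r k : ℕ) :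
    (∀ g : ℕ → G, (∀ i ≤ k, g i ∈ S i) → TailIn M S r k (seqComm g k)) ↔
      ∀ g : ℕ → G, (∀ i ≤ k + r, g i ∈ S i) → seqComm g (k + r) ∈ M := by
  induction r generalizing k with
  | zero => rfl
  | succ r ih =>
    have := ih (k + 1)
    rw [show k + 1 + r = k + (r + 1) by omega] at this
    rw [← this]
    constructor
    · intro H g hg
      exact H g (fun i hi => hg i (by omega)) _ (hg _ le_rfl)
    · intro H g hg y hy
      have h1 := H (Function.update g (k + 1) y) (fun i hi => by
        rcases eq_or_ne i (k + 1) with rfl | hne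
        · simpa using hy
        · rw [Function.update_of_ne hne]; exact hg i (by omega))
      have h2 : seqComm (Function.update g (k + 1) y) (k + 1) = comm (seqComm g k) y := by
        simp only [seqComm, Function.update_self]
        rw [seqComm_congr (h := g)]
        intro i hi
        rw [Function.update_of_ne (by omega)]
      rwa [h2] at h1

lemma forall_tailIn_zero_iff (M : Subgroup G) (S : ℕ → Set G) (n : ℕ) :
    (∀ x ∈ S 0, TailIn M S n 0 x) ↔
      ∀ g : ℕ → G, (∀ i ≤ n, g i ∈ S i) → seqComm g n ∈ M := by
  have := tailIn_iff_seqComm M S n 0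
  rw [zero_add] at this
  rw [← this]
  constructor
  · intro H g hg
    exact H _ (hg 0 le_rfl)
  · intro H x hx
    exact H (fun _ => x) (fun i hi => by obtain rfl : i = 0 := by omega
                                         exact hx)

variable {M : Subgroup G} {S S' : ℕ → Set G}

lemma TailIn.mono {r k : ℕ} {x : G} (hS : ∀ i > k, S' i ⊆ S i) (h : TailIn M S r k x) :
    TailIn M S' r k x := by
  induction r generalizing k x with
  | zero => exact h
  | succ r ih =>
    intro g hg
    exact ih (fun i hi => hS i (by omega)) (h g (hS _ (by omega) hg))

/-- Elements of `D k` normalize all `S i` with `i > k`, and commutators of elements of `D k` with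
elements of `S (k + 1)` lie in `D (k + 1)`. -/
structure Stabilizes (D : ℕ → Subgroup G) (S : ℕ → Set G) : Prop where
  conj : ∀ k i, k < i → ∀ d ∈ D k, ∀ s ∈ S i, d⁻¹ * s * d ∈ S i
  comm : ∀ k, ∀ d ∈ D k, ∀ s ∈ S (k + 1), comm d s ∈ D (k + 1)

lemma TailIn.conj [M.Normal] {r k : ℕ} {x d : G}
    (hd : ∀ i > k, ∀ s ∈ S i, d * s * d⁻¹ ∈ S i) (h : TailIn M S r k x) :
    TailIn M S r k (d⁻¹ * x * d) := by
  induction r generalizing k x with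
  | zero =>
    change d⁻¹ * x * d ∈ M
    simpa using Subgroup.Normal.conj_mem ‹M.Normal› x h d⁻¹
  | succ r ih =>
    intro g hg
    have : CoprimeCommutators.comm (d⁻¹ * x * d) g
        = d⁻¹ * CoprimeCommutators.comm x (d * g * d⁻¹) * d := by
      simp only [CoprimeCommutators.comm]; group
    rw [this]
    exact ih (fun i hi => hd i (by omega)) (h _ (hd _ (by omega) g hg))

variable {D : ℕ → Subgroup G}

lemma Stabilizes.tailIn_conj [M.Normal] (hD : Stabilizes D S) {r k : ℕ} {x d : G} (hd : d ∈ D k)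
    (h : TailIn M S r k x) : TailIn M S r k (d⁻¹ * x * d) :=
  h.conj fun i hi s hs => by simpa using hD.conj k i hi d⁻¹ (inv_mem hd) s hs

/-- Rests on `[xd, g] = [x, g]^d [d, g]`. Only the right factor has to lie in `D k`; the left one is
arbitrary. -/
lemma Stabilizes.tailIn_mul [M.Normal] (hD : Stabilizes D S) {r k : ℕ} {x d : G} (hd : d ∈ D k)
    (hx : TailIn M S r k x) (h : TailIn M S r k d) : TailIn M S r k (x * d) := by
  induction r generalizing k x d with
  | zero => exact mul_mem hx h
  | succ r ih =>
    intro g hg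
    have : CoprimeCommutators.comm (x * d) g
        = d⁻¹ * CoprimeCommutators.comm x g * d * CoprimeCommutators.comm d g := by
      simp only [CoprimeCommutators.comm]; group
    rw [this]
    refine ih (hD.comm k d hd g hg) ((hx g hg).conj fun i hi s hs => ?_) (h g hg)
    simpa using hD.conj k i (by omega) d⁻¹ (inv_mem hd) s hs

lemma Stabilizes.tailIn_inv [M.Normal] (hD : Stabilizes D S) {r k : ℕ} {d : G} (hd : d ∈ D k)
    (h : TailIn M S r k d) : TailIn M S r k d⁻¹ := by
  induction r generalizing k d with
  | zero => exact inv_mem h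
  | succ r ih =>
    intro g hg
    have : CoprimeCommutators.comm d⁻¹ g
        = d⁻¹⁻¹ * (CoprimeCommutators.comm d g)⁻¹ * d⁻¹ := by
      simp only [CoprimeCommutators.comm]; group
    rw [this]
    refine (ih (hD.comm k d hd g hg) (h g hg)).conj fun i hi s hs => ?_
    simpa using hD.conj k i (by omega) d hd s hs

/-- A sequence of subgroups in which each term is normalized by the earlier ones. -/
def NormalizingChain (A : ℕ → Subgroup G) : Prop :=
  ∀ i j, j ≤ i → ∀ a ∈ A j, ∀ s ∈ A i, a⁻¹ * s * a ∈ A i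

lemma NormalizingChain.stabilizes {A : ℕ → Subgroup G} (hA : NormalizingChain A)
    (hS : ∀ k, S k ⊆ A k) (hconj : ∀ i j, j ≤ i → ∀ a ∈ A j, ∀ s ∈ S i, a⁻¹ * s * a ∈ S i) :
    Stabilizes A S where
  conj k i hki d hd s hs := hconj i k hki.le d hd s hs
  comm k d hd s hs := by
    have := mul_mem (hA (k + 1) k (by omega) d hd _ (inv_mem (hS _ hs))) (hS _ hs)
    simpa only [CoprimeCommutators.comm, mul_assoc] using this

lemma NormalizingChain.comm_mem {A : ℕ → Subgroup G} (hA : NormalizingChain A) {k : ℕ} {x g : G}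
    (hx : x ∈ A k) (hg : g ∈ A (k + 1)) : comm x g ∈ A (k + 1) := by
  have := mul_mem (hA (k + 1) k (by omega) x hx _ (inv_mem hg)) hg
  simpa only [CoprimeCommutators.comm, mul_assoc] using this

lemma comm_mem_of_mem_right {U : Subgroup G} [U.Normal] (x : G) {g : G} (hg : g ∈ U) :
    comm x g ∈ U := by
  have := mul_mem (Subgroup.Normal.conj_mem ‹U.Normal› _ (inv_mem hg) x⁻¹) hg
  simpa only [CoprimeCommutators.comm, mul_assoc, inv_inv] using this

lemma comm_mem_of_mem_left {U : Subgroup G} [U.Normal] {x : G} (g : G) (hx : x ∈ U) :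
    comm x g ∈ U := by
  have := mul_mem (inv_mem hx) (Subgroup.Normal.conj_mem ‹U.Normal› _ hx g⁻¹)
  simpa only [CoprimeCommutators.comm, mul_assoc, inv_inv] using this

lemma comm_mul_right (x h k : G) : comm x (h * k) = comm x k * (k⁻¹ * comm x h * k) := by
  simp only [comm]; group

/-- Here `E` is `h ↦ [x, h]`, or the identity at the first entry. The identity `hE` splits `E (h *
k)` into a term with an `H`-entry, covered by `hX`, and one with a `K`-entry. Later entries are
treated before earlier ones, until only `K`-entries remain and `hK` applies. -/
lemma tailIn_of_factorization [M.Normal] {Q : ℕ → Subgroup G} (hQ : NormalizingChain Q)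
    {K H : ℕ → Set G} {I : Set ℕ} (hKQ : ∀ i, K i ⊆ Q i) (hHQ : ∀ i, H i ⊆ Q i)
    (hI : ∀ i ∈ I, ∀ g ∈ Q i, ∃ h ∈ H i, ∃ k ∈ K i, g = h * k)
    (hI' : ∀ i ∉ I, (Q i : Set G) ⊆ K i) (r m : ℕ) (E : G → G)
    (hE : ∀ h k, E (h * k) = E k * (k⁻¹ * E h * k)) (hEQ : ∀ g ∈ Q m, E g ∈ Q m)
    (hK : ∀ g ∈ K m, TailIn M K r m (E g))
    (hX : ∀ j ∈ I, m ≤ j → ∀ g ∈ Function.update (fun i => (Q i : Set G)) j (H j) m,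
      TailIn M (Function.update (fun i => (Q i : Set G)) j (H j)) r m (E g)) :
    ∀ g ∈ Q m, TailIn M (fun i => (Q i : Set G)) r m (E g) := by
  have hst : Stabilizes Q (fun i => (Q i : Set G)) := hQ.stabilizes (fun _ => le_rfl) hQ
  induction r generalizing m E with
  | zero =>
    intro g hg
    by_cases hm : m ∈ I
    · obtain ⟨h, hh, k, hk, rfl⟩ := hI m hm g hg
      rw [hE]
      refine hst.tailIn_mul (hQ m m le_rfl k (hKQ _ hk) _ (hEQ _ (hHQ _ hh))) (hK k hk)
        (hst.tailIn_conj (hKQ _ hk) (hX m hm le_rfl h (by simpa using hh)))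
    · exact hK g (hI' m hm hg)
  | succ r ih =>
    have h1 : ∀ g ∈ K m, TailIn M (fun i => (Q i : Set G)) (r + 1) m (E g) := by
      intro g hg
      refine ih (m + 1) (comm (E g)) (comm_mul_right _)
        (fun y hy => hQ.comm_mem (hEQ _ (hKQ _ hg)) hy) (hK g hg) fun j hj hmj => ?_
      refine hX j hj (by omega) g ?_
      rw [Function.update_of_ne (by omega)]
      exact hKQ _ hg
    intro g hg
    by_cases hm : m ∈ I
    · obtain ⟨h, hh, k, hk, rfl⟩ := hI m hm g hg
      rw [hE]
      refine hst.tailIn_mul (hQ m m le_rfl k (hKQ _ hk) _ (hEQ _ (hHQ _ hh))) (h1 k hk)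
        (hst.tailIn_conj (hKQ _ hk) ((hX m hm le_rfl h (by simpa using hh)).mono fun i hi => ?_))
      rw [Function.update_of_ne (by omega)]
    · exact h1 g (hI' m hm hg)

lemma seqComm_mem_of_factorization [M.Normal] {Q : ℕ → Subgroup G} (hQ : NormalizingChain Q)
    {K H : ℕ → Set G} {I : Set ℕ} (hKQ : ∀ i, K i ⊆ Q i) (hHQ : ∀ i, H i ⊆ Q i)
    (hI : ∀ i ∈ I, ∀ g ∈ Q i, ∃ h ∈ H i, ∃ k ∈ K i, g = h * k)
    (hI' : ∀ i ∉ I, (Q i : Set G) ⊆ K i) (n : ℕ)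
    (hK : ∀ g : ℕ → G, (∀ i ≤ n, g i ∈ K i) → seqComm g n ∈ M)
    (hX : ∀ j ∈ I, ∀ g : ℕ → G,
      (∀ i ≤ n, g i ∈ Function.update (fun i => (Q i : Set G)) j (H j) i) → seqComm g n ∈ M)
    (g : ℕ → G) (hg : ∀ i ≤ n, g i ∈ Q i) : seqComm g n ∈ M :=
  (forall_tailIn_zero_iff M (fun i => (Q i : Set G)) n).1
    (tailIn_of_factorization hQ hKQ hHQ hI hI' n 0 id (fun h k => by simp only [id]; group)
      (fun _ h => h) ((forall_tailIn_zero_iff _ _ _).2 hK)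
      fun j hj _ => (forall_tailIn_zero_iff _ _ _).2 (hX j hj)) g hg

/-! ### From cosets to subgroups -/

section Cosets

variable {A P : ℕ → Subgroup G} {U V : Subgroup G} {J : Set ℕ} {a : ℕ → G}

/-- The single element `a i` for `i ∈ J`, and the coset `a i (P i ∩ V)` for `i ∉ J`. -/
def startSet (P : ℕ → Subgroup G) (V : Subgroup G) (J : Set ℕ) (a : ℕ → G) (i : ℕ) : Set G :=
  {g | (i ∈ J → g = a i) ∧ (i ∉ J → (a i)⁻¹ * g ∈ P i ∧ (a i)⁻¹ * g ∈ V)}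

/-- The elements of `P i` in the coset `a i U` for `i ∈ J`, and those in `V` for `i ∉ J`. -/
def finalSet (P : ℕ → Subgroup G) (U V : Subgroup G) (J : Set ℕ) (a : ℕ → G) (i : ℕ) : Set G :=
  {g | g ∈ P i ∧ (i ∈ J → (a i)⁻¹ * g ∈ U) ∧ (i ∉ J → g ∈ V)}

/-- The elements of `A i`, required to lie in `U` unless `i ∈ J`. -/
def bigSet (A : ℕ → Subgroup G) (U : Subgroup G) (J : Set ℕ) (i : ℕ) : Set G :=
  {g | g ∈ A i ∧ (i ∉ J → g ∈ U)}

/-- Start sets are exchanged for final sets from the last entry backwards. For `m ∉ J` both `a m`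
and `a m * v` are start entries, and `E v` is the quotient of `E (a m * v)` by a conjugate of `E (a
m)`. For `m ∈ J` the extra factor coming from `u ∈ U` has one unrestricted entry fewer, so `hbig`
covers it. -/
lemma tailIn_finalSet [M.Normal] [U.Normal] [V.Normal] (hA : NormalizingChain A)
    (hPA : ∀ i, P i ≤ A i) (hP : ∀ i j, j ≤ i → ∀ a ∈ A j, ∀ s ∈ P i, a⁻¹ * s * a ∈ P i)
    (hVU : V ≤ U) (haA : ∀ i, a i ∈ A i) (haU : ∀ i ∉ J, a i ∈ U) (r m : ℕ) (E : G → G)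
    (hE : ∀ h k, E (h * k) = E k * (k⁻¹ * E h * k)) (hEA : ∀ g ∈ A m, E g ∈ A m)
    (hEU : ∀ g ∈ U, E g ∈ U)
    (hst : ∀ g ∈ startSet P V J a m, TailIn M (startSet P V J a) r m (E g))
    (hbig : ∀ j ∈ J, m ≤ j → ∀ g ∈ bigSet A U (J \ {j}) m,
      TailIn M (bigSet A U (J \ {j})) r m (E g)) :
    ∀ g ∈ finalSet P U V J a m, TailIn M (finalSet P U V J a) r m (E g) := by
  have stA : ∀ j, Stabilizes A (bigSet A U (J \ {j})) := fun j =>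
    hA.stabilizes (fun k x hx => hx.1) fun i k hki d hd s hs =>
      ⟨hA i k hki d hd s hs.1, fun h => by
        simpa using Subgroup.Normal.conj_mem ‹U.Normal› _ (hs.2 h) d⁻¹⟩
  -- Elements of `U` act trivially modulo `U`, so they preserve the cosets `a i U`; elements of `A
  -- k` need not.
  have stU : Stabilizes (fun k => A k ⊓ U) (finalSet P U V J a) :=
    ⟨fun k i hki d hd s hs => ⟨hP i k hki.le d hd.1 s hs.1, fun h => by
        have h1 := mul_mem (mul_mem (Subgroup.Normal.conj_mem ‹U.Normal› _ (inv_mem hd.2) (a i)⁻¹)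
          (hs.2.1 h)) hd.2
        simpa [mul_assoc] using h1, fun h => by
        simpa using Subgroup.Normal.conj_mem ‹V.Normal› _ (hs.2.2 h) d⁻¹⟩,
      fun k d hd s hs => ⟨hA.comm_mem hd.1 (hPA _ hs.1), comm_mem_of_mem_left _ hd.2⟩⟩
  have hstart : ∀ i, ∀ g ∈ startSet P V J a i, g ∈ A i ∧ (i ∉ J → g ∈ U) := by
    intro i g hg
    by_cases hi : i ∈ J
    · rw [hg.1 hi]
      exact ⟨haA i, fun h => absurd hi h⟩
    · obtain ⟨h1, h2⟩ := hg.2 hi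
      exact ⟨by simpa using mul_mem (haA i) (hPA _ h1),
        fun _ => by simpa using mul_mem (haU i hi) (hVU h2)⟩
  have key : ∀ (r m : ℕ) (E : G → G) (_ : ∀ h k, E (h * k) = E k * (k⁻¹ * E h * k))
      (_ : ∀ g ∈ A m, E g ∈ A m) (_ : ∀ g ∈ U, E g ∈ U)
      (_ : ∀ j ∈ J, m ≤ j → ∀ g ∈ bigSet A U (J \ {j}) m,
        TailIn M (bigSet A U (J \ {j})) r m (E g)),
      (∀ g ∈ startSet P V J a m, TailIn M (finalSet P U V J a) r m (E g)) →
      ∀ g ∈ finalSet P U V J a m, TailIn M (finalSet P U V J a) r m (E g) := by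
    clear hE hEA hEU hbig hst r m E
    intro r m E hE hEA hEU hbig h1 g hg
    obtain ⟨u, rfl⟩ : ∃ u, g = a m * u := ⟨(a m)⁻¹ * g, by simp⟩
    by_cases hm : m ∈ J
    · have hu : u ∈ U := by simpa using hg.2.1 hm
      have huA : u ∈ A m := by simpa using mul_mem (inv_mem (haA m)) (hPA _ hg.1)
      set q := u⁻¹ * E (a m) * u with hq
      have hqA : q ∈ A m := hA m m le_rfl _ huA _ (hEA _ (haA m))
      -- This order is needed because `q` may lie outside `U`, while the right factor of
      -- `tailIn_mul` must lie in it.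
      have e1 : E (a m * u) = q * (q⁻¹ * E u * q) := by rw [hE, ← hq]; group
      rw [e1]
      refine stU.tailIn_mul ⟨hA m m le_rfl _ hqA _ (hEA _ huA), ?_⟩
        (stU.tailIn_conj ⟨huA, hu⟩ (h1 _ ⟨fun _ => rfl, fun h => absurd hm h⟩)) ?_
      · simpa using Subgroup.Normal.conj_mem ‹U.Normal› _ (hEU _ hu) q⁻¹
      · refine ((stA m).tailIn_conj hqA (hbig m hm le_rfl u ⟨huA, fun _ => hu⟩)).mono ?_
        intro i hi s hs
        exact ⟨hPA _ hs.1, fun h => hVU (hs.2.2 fun h' => h ⟨h', by simpa using hi.ne'⟩)⟩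
    · have hgP := hg.1
      have hgV := hg.2.2 hm
      generalize a m * u = v at hgP hgV ⊢
      have hvA := hPA _ hgP
      have ha1 : TailIn M (finalSet P U V J a) r m (E (a m)) :=
        h1 _ ⟨fun _ => rfl, fun _ => by simp⟩
      have ha2 : TailIn M (finalSet P U V J a) r m (E (a m * v)) :=
        h1 _ ⟨fun h => absurd h hm, fun _ => by simpa using ⟨hgP, hgV⟩⟩
      set q := v⁻¹ * E (a m) * v with hq
      have hqD : q ∈ A m ⊓ U := ⟨hA m m le_rfl _ hvA _ (hEA _ (haA m)), by
        simpa using Subgroup.Normal.conj_mem ‹U.Normal› _ (hEU _ (haU m hm)) v⁻¹⟩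
      have e1 : E v = E (a m * v) * q⁻¹ := by rw [hE, ← hq]; group
      rw [e1]
      exact stU.tailIn_mul (inv_mem hqD) ha2
        (stU.tailIn_inv hqD (stU.tailIn_conj ⟨hvA, hVU hgV⟩ ha1))
  induction r generalizing m E with
  | zero => exact key 0 m E hE hEA hEU hbig hst
  | succ r ih =>
    refine key (r + 1) m E hE hEA hEU hbig fun g hg => ?_
    obtain ⟨hgA, hgU⟩ := hstart m g hg
    refine ih (m + 1) (comm (E g)) (comm_mul_right _) (fun y hy => hA.comm_mem (hEA _ hgA) hy)
      (fun y hy => comm_mem_of_mem_right _ hy) (hst g hg) fun j hj hmj => ?_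
    exact hbig j hj (by omega) g ⟨hgA, fun h => hgU fun h' => h ⟨h', by simp; omega⟩⟩

lemma seqComm_mem_of_finalSet [M.Normal] [U.Normal] [V.Normal] (hA : NormalizingChain A)
    (hPA : ∀ i, P i ≤ A i) (hP : ∀ i j, j ≤ i → ∀ a ∈ A j, ∀ s ∈ P i, a⁻¹ * s * a ∈ P i)
    (hVU : V ≤ U) (haA : ∀ i, a i ∈ A i) (haU : ∀ i ∉ J, a i ∈ U) (n : ℕ)
    (hst : ∀ g : ℕ → G, (∀ i ≤ n, g i ∈ startSet P V J a i) → seqComm g n ∈ M)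
    (hbig : ∀ j ∈ J, ∀ g : ℕ → G, (∀ i ≤ n, g i ∈ bigSet A U (J \ {j}) i) → seqComm g n ∈ M)
    (g : ℕ → G) (hg : ∀ i ≤ n, g i ∈ finalSet P U V J a i) : seqComm g n ∈ M :=
  (forall_tailIn_zero_iff M _ n).1
    (tailIn_finalSet hA hPA hP hVU haA haU n 0 id (fun h k => by simp only [id]; group)
      (fun _ h => h) (fun _ h => h) ((forall_tailIn_zero_iff _ _ _).2 hst)
      fun j hj _ => (forall_tailIn_zero_iff _ _ _).2 (hbig j hj)) g hg

end Cosets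

end Group

/-! ### Prime parts of elements of finite groups -/

/-- A finite nilpotent group is the direct product of its Sylow subgroups, and elements of order
prime to `p` have trivial `p`-component. -/
lemma not_dvd_orderOf_mul_of_isNilpotent {Q : Type*} [Group Q] [Finite Q] [Group.IsNilpotent Q]
    {p : ℕ} (hp : p.Prime) {x y : Q} (hx : ¬ p ∣ orderOf x) (hy : ¬ p ∣ orderOf y) :
    ¬ p ∣ orderOf (x * y) := by
  intro h
  have := Fact.mk hp
  obtain ⟨e⟩ := (Group.isNilpotent_of_finite_tfae (G := Q)).out 0 4 |>.1 ‹_›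
  set f := e.symm
  have triv : ∀ z : Q, ¬ p ∣ orderOf z → ∀ (q : (Nat.card Q).primeFactors) (P : Sylow q Q),
      (q : ℕ) = p → f z q P = 1 := by
    intro z hz q P hq
    have := Fact.mk (Nat.prime_of_mem_primeFactors q.2)
    obtain ⟨k, hk⟩ := IsPGroup.iff_orderOf.1 P.isPGroup' (f z q P)
    have hdvd : orderOf (f z q P) ∣ orderOf z := by
      apply orderOf_dvd_of_pow_eq_one
      have h1 : f (z ^ orderOf z) q P = 1 := by rw [pow_orderOf_eq_one, map_one]; rfl
      rwa [map_pow] at h1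
    rw [hk, hq] at hdvd
    rcases Nat.eq_zero_or_pos k with rfl | hk0
    · simpa using hk
    · exact absurd ((dvd_pow_self p hk0.ne').trans hdvd) hz
  set w := (x * y) ^ (orderOf (x * y) / p) with hw
  have hwo : orderOf w = p := orderOf_pow_orderOf_div (orderOf_pos _).ne' h
  have : f w = 1 := by
    funext q P
    by_cases hq : (q : ℕ) = p
    · rw [hw, map_pow, map_mul]
      change (f x q P * f y q P) ^ _ = 1
      rw [triv x hx q P hq, triv y hy q P hq, one_mul, one_pow]
    · have := Fact.mk (Nat.prime_of_mem_primeFactors q.2)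
      obtain ⟨k, hk⟩ := IsPGroup.iff_orderOf.1 P.isPGroup' (f w q P)
      have hdvd : orderOf (f w q P) ∣ p := by
        apply orderOf_dvd_of_pow_eq_one
        have h1 : f (w ^ p) q P = 1 := by rw [← hwo, pow_orderOf_eq_one, map_one]; rfl
        rwa [map_pow] at h1
      rw [hk] at hdvd
      rcases Nat.eq_zero_or_pos k with rfl | hk0
      · exact orderOf_eq_one_iff.1 (by simpa using hk)
      · exact absurd ((Nat.prime_dvd_prime_iff_eq (Nat.prime_of_mem_primeFactors q.2) hp).1
          ((dvd_pow_self _ hk0.ne').trans hdvd)) hq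
  rw [(map_eq_one_iff f f.injective).1 this, orderOf_one] at hwo
  exact hp.one_lt.ne hwo

lemma exists_mul_eq_of_primes (σ : Set ℕ) {n : ℕ} (hn : n ≠ 0) :
    ∃ a b, n = a * b ∧ (∀ p, p.Prime → p ∣ a → p ∈ σ) ∧ ∀ p, p.Prime → p ∣ b → p ∉ σ := by
  induction n using induction_on_primes with
  | zero => exact absurd rfl hn
  | one => exact ⟨1, 1, rfl, fun p hp h => absurd h hp.not_dvd_one,
      fun p hp h => absurd h hp.not_dvd_one⟩
  | prime_mul p n hp ih =>
    obtain ⟨a, b, rfl, ha, hb⟩ := ih (right_ne_zero_of_mul hn)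
    by_cases h : p ∈ σ
    · refine ⟨p * a, b, (mul_assoc _ _ _).symm, fun q hq hd => ?_, hb⟩
      rcases (Nat.Prime.dvd_mul hq).1 hd with h1 | h1
      · rwa [(Nat.prime_dvd_prime_iff_eq hq hp).1 h1]
      · exact ha q hq h1
    · refine ⟨a, p * b, mul_left_comm _ _ _, ha, fun q hq hd => ?_⟩
      rcases (Nat.Prime.dvd_mul hq).1 hd with h1 | h1
      · rwa [(Nat.prime_dvd_prime_iff_eq hq hp).1 h1]
      · exact hb q hq h1

lemma exists_zpow_primes (σ : Set ℕ) {Q : Type*} [Group Q] [Finite Q] (x : Q) :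
    ∃ k : ℤ, (∀ p, p.Prime → p ∣ orderOf (x ^ k) → p ∈ σ) ∧
      ∀ p, p.Prime → p ∣ orderOf ((x ^ k)⁻¹ * x) → p ∉ σ := by
  obtain ⟨a, b, hab, ha, hb⟩ := exists_mul_eq_of_primes σ (orderOf_pos x).ne'
  have hc : Nat.Coprime a b := Nat.coprime_of_dvd fun p hp h1 h2 => hb p hp h2 (ha p hp h1)
  obtain ⟨u, v, huv⟩ := (Nat.isCoprime_iff_coprime.2 hc)
  have hx : ∀ k : ℤ, x ^ ((a : ℤ) * b * k) = 1 := fun k => by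
    rw [zpow_mul, ← Nat.cast_mul, ← hab, zpow_natCast, pow_orderOf_eq_one, one_zpow]
  -- By Bézout, `v * b` is `1` modulo `a` and `0` modulo `b`.
  refine ⟨v * b, fun p hp hd => ha p hp (hd.trans (orderOf_dvd_of_pow_eq_one ?_)),
    fun p hp hd => hb p hp (hd.trans (orderOf_dvd_of_pow_eq_one ?_))⟩
  · rw [← zpow_natCast, ← zpow_mul, ← hx v]; ring_nf
  · have : (x ^ (v * b : ℤ))⁻¹ * x = x ^ (u * a : ℤ) := by
      nth_rewrite 2 [← zpow_one x]
      rw [← zpow_neg, ← zpow_add, ← huv]; ring_nf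
    rw [this, ← zpow_natCast, ← zpow_mul, ← hx u]; ring_nf

/-! ### Supports of elements and Hall subgroups -/

section Topology

variable {G : Type u} [Group G] [TopologicalSpace G]

lemma card_map_mk (U : OpenNormalSubgroup G) (H : Subgroup G) :
    U.toSubgroup.relIndex H = Nat.card (H.map (QuotientGroup.mk' U.toSubgroup)) := by
  rw [← Subgroup.relIndex_ker, QuotientGroup.ker_mk']

lemma primesOf_mono {H K : Subgroup G} (h : H ≤ K) : primesOf H ⊆ primesOf K := by
  rintro p ⟨hp, U, hU⟩
  refine ⟨hp, U, hU.trans ?_⟩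
  rw [card_map_mk, card_map_mk]
  exact Subgroup.card_dvd_of_le (Subgroup.map_mono h)

/-- The primes dividing the index of an open normal subgroup. -/
def indexPrimes (U : OpenNormalSubgroup G) : Set ℕ := {p | p.Prime ∧ p ∣ Nat.card (G ⧸ U.toSubgroup)}

lemma indexPrimes_anti {U V : OpenNormalSubgroup G} (h : U ≤ V) : indexPrimes V ⊆ indexPrimes U :=
  fun _ hp => ⟨hp.1, hp.2.trans (Subgroup.index_dvd_of_le (H := U.toSubgroup) h)⟩

instance : Nonempty (OpenNormalSubgroup G) := ⟨{ (⊤ : OpenSubgroup G) with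
  isNormal' := (inferInstance : (⊤ : Subgroup G).Normal) }⟩

lemma orderOf_mk_dvd {U V : OpenNormalSubgroup G} (h : U ≤ V) (x : G) :
    orderOf (x : G ⧸ V.toSubgroup) ∣ orderOf (x : G ⧸ U.toSubgroup) :=
  orderOf_map_dvd (QuotientGroup.map U.toSubgroup V.toSubgroup (MonoidHom.id G) h)
    (x : G ⧸ U.toSubgroup)

/-- The compactness passage from finite quotients to `G`. -/
lemma exists_forall_mem_of_antitone [CompactSpace G] (F : OpenNormalSubgroup G → Set G)
    (hF : ∀ U V, U ≤ V → F U ⊆ F V) (hcl : ∀ U, IsClosed (F U)) (hne : ∀ U, (F U).Nonempty) :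
    ∃ x, ∀ U, x ∈ F U := by
  obtain ⟨x, hx⟩ := IsCompact.nonempty_iInter_of_directed_nonempty_isCompact_isClosed F
    (fun U V => ⟨U ⊓ V, hF _ _ inf_le_left, hF _ _ inf_le_right⟩) hne
    (fun U => (hcl U).isCompact) hcl
  exact ⟨x, Set.mem_iInter.1 hx⟩

lemma isNilpotent_map_mk {A : Subgroup G} (hA : IsPronilpotent A) (U : OpenNormalSubgroup G) :
    Group.IsNilpotent (A.map (QuotientGroup.mk' U.toSubgroup)) := by
  let N : OpenNormalSubgroup A :=
    { U.toOpenSubgroup.comap A.subtype continuous_subtype_val with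
      isNormal' := (inferInstance : (U.toSubgroup.comap A.subtype).Normal) }
  have : N.toSubgroup.Normal := N.isNormal'
  have := hA N
  let f : A →* A.map (QuotientGroup.mk' U.toSubgroup) :=
    (QuotientGroup.mk' U.toSubgroup).subgroupMap A
  have hN : N.toSubgroup ≤ f.ker := fun a ha => by
    have ha : (a : G) ∈ U.toSubgroup := ha
    exact Subtype.ext ((QuotientGroup.eq_one_iff _).2 ha)
  refine Group.nilpotent_of_surjective (QuotientGroup.lift N.toSubgroup f hN) ?_
  exact QuotientGroup.lift_surjective_of_surjective _ _
    (MonoidHom.subgroupMap_surjective _ _) hN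

variable [IsTopologicalGroup G]

lemma isClopen_setOf_mk (U : OpenNormalSubgroup G) (P : G ⧸ U.toSubgroup → Prop) :
    IsClopen {x : G | P x} := by
  have := QuotientGroup.discreteTopology U.isOpen'
  exact (isClopen_discrete {y | P y}).preimage (QuotientGroup.continuous_mk)

/-- The primes dividing the order of `x`. -/
def supp (x : G) : Set ℕ := primesOf (closedPowers x)

lemma self_mem_closedPowers (x : G) : x ∈ closedPowers x :=
  Subgroup.le_topologicalClosure _ (Subgroup.mem_zpowers x)

lemma closedPowers_le {x : G} {H : Subgroup G} (hH : IsClosed (H : Set G)) (hx : x ∈ H) :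
    closedPowers x ≤ H :=
  Subgroup.topologicalClosure_minimal _ (by simpa using hx) hH

lemma mem_supp {p : ℕ} {x : G} :
    p ∈ supp x ↔ p.Prime ∧ ∃ U : OpenNormalSubgroup G, p ∣ orderOf (x : G ⧸ U.toSubgroup) := by
  refine and_congr_right fun _ => exists_congr fun U => ?_
  have : (closedPowers x).map (QuotientGroup.mk' U.toSubgroup)
      = Subgroup.zpowers (x : G ⧸ U.toSubgroup) := by
    apply le_antisymm
    · rw [Subgroup.map_le_iff_le_comap]
      exact closedPowers_le (isClopen_setOf_mk U (· ∈ Subgroup.zpowers (x : G ⧸ U.toSubgroup))).1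
        (Subgroup.mem_zpowers _)
    · rw [Subgroup.zpowers_le]
      exact ⟨x, self_mem_closedPowers x, rfl⟩
  rw [card_map_mk, this, Nat.card_zpowers]

lemma coprimeOrders_iff {x y : G} : CoprimeOrders x y ↔ Disjoint (supp x) (supp y) := Iff.rfl

lemma supp_subset_primesOf {x : G} {A : Subgroup G} (hA : IsClosed (A : Set G)) (hx : x ∈ A) :
    supp x ⊆ primesOf A :=
  primesOf_mono (closedPowers_le hA hx)

lemma supp_subset_of_mem_closedPowers {x y : G} (h : y ∈ closedPowers x) : supp y ⊆ supp x :=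
  supp_subset_primesOf (Subgroup.isClosed_topologicalClosure _) h

lemma supp_one : supp (1 : G) = ∅ := by
  ext p
  simp only [mem_supp, QuotientGroup.mk_one, orderOf_one, Set.mem_empty_iff_false, iff_false]
  rintro ⟨hp, _, h⟩
  exact hp.not_dvd_one h

lemma supp_inv (x : G) : supp x⁻¹ = supp x := by
  ext p
  simp [mem_supp, QuotientGroup.mk_inv]

lemma supp_conj (g x : G) : supp (g⁻¹ * x * g) = supp x := by
  ext p
  simp only [mem_supp]
  refine and_congr_right fun _ => exists_congr fun U => ?_
  have := MulEquiv.orderOf_eq (MulAut.conj (g⁻¹ : G ⧸ U.toSubgroup)) x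
  rw [MulAut.conj_apply, inv_inv] at this
  rw [← this]
  rfl

lemma isOpen_setOf_mem_supp (p : ℕ) : IsOpen {x : G | p ∈ supp x} := by
  have : {x : G | p ∈ supp x} = ⋃ U : OpenNormalSubgroup G,
      {x | p.Prime ∧ p ∣ orderOf (x : G ⧸ U.toSubgroup)} := by
    ext x; simp [mem_supp]
  rw [this]
  exact isOpen_iUnion fun U => (isClopen_setOf_mk U fun y => p.Prime ∧ p ∣ orderOf y).2

lemma isClosed_setOf_supp_subset (τ : Set ℕ) : IsClosed {x : G | supp x ⊆ τ} := by
  have : {x : G | supp x ⊆ τ} = ⋂ p ∈ τᶜ, {x : G | p ∈ supp x}ᶜ := by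
    ext x
    simp only [Set.mem_ofPred_eq, Set.mem_iInter, Set.mem_compl_iff]
    exact ⟨fun h p hp hx => hp (h hx), fun h p hx => by_contra fun hp => h p hp hx⟩
  rw [this]
  exact isClosed_biInter fun p _ => (isOpen_setOf_mem_supp p).isClosed_compl

/-- A common prime of two orders is visible in open quotients, so failure of coprimality is an open
condition. This makes sets of coprime sequences compact. -/
lemma isClosed_setOf_coprimeOrders : IsClosed {z : G × G | CoprimeOrders z.1 z.2} := by
  have : {z : G × G | CoprimeOrders z.1 z.2}
      = ⋂ p : ℕ, ({z : G × G | p ∈ supp z.1} ∩ {z : G × G | p ∈ supp z.2})ᶜ := by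
    ext z
    simp [coprimeOrders_iff, Set.disjoint_left]
  rw [this]
  exact isClosed_iInter fun p => (((isOpen_setOf_mem_supp p).preimage continuous_fst).inter
    ((isOpen_setOf_mem_supp p).preimage continuous_snd)).isClosed_compl

lemma mem_of_disjoint_indexPrimes {U : OpenNormalSubgroup G} {x : G}
    (h : Disjoint (supp x) (indexPrimes U)) : x ∈ U.toSubgroup := by
  rw [← QuotientGroup.eq_one_iff, ← orderOf_eq_one_iff]
  by_contra hne
  obtain ⟨p, hp, hd⟩ := Nat.exists_prime_and_dvd hne
  exact Set.disjoint_left.1 h (mem_supp.2 ⟨hp, U, hd⟩) ⟨hp, hd.trans (orderOf_dvd_natCard _)⟩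

section Compact

variable [CompactSpace G]

lemma indexPrimes_finite (U : OpenNormalSubgroup G) : (indexPrimes U).Finite :=
  (Nat.card (G ⧸ U.toSubgroup)).primeFactors.finite_toSet.subset fun p hp => by
    simpa using ⟨hp.1, hp.2, Nat.card_pos.ne'⟩

/-- An element of a profinite group is a product of a `σ`-element and a `σ'`-element which are
powers of it. -/
lemma exists_mul_eq_of_supp (σ : Set ℕ) (x : G) : ∃ a ∈ closedPowers x, ∃ b ∈ closedPowers x,
    x = a * b ∧ supp a ⊆ σ ∧ Disjoint (supp b) σ := by
  let F : OpenNormalSubgroup G → Set G := fun U => closedPowers x ∩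
    {a | (∀ p, p.Prime → p ∣ orderOf (a : G ⧸ U.toSubgroup) → p ∈ σ) ∧
      ∀ p, p.Prime → p ∣ orderOf ((a : G ⧸ U.toSubgroup)⁻¹ * (x : G ⧸ U.toSubgroup)) → p ∉ σ}
  obtain ⟨a, ha⟩ := exists_forall_mem_of_antitone F
    (fun U V h a ha => ⟨ha.1, fun p hp hd => ha.2.1 p hp (hd.trans (orderOf_mk_dvd h a)),
      fun p hp hd => ha.2.2 p hp (hd.trans (orderOf_mk_dvd h (a⁻¹ * x)))⟩)
    (fun U => (Subgroup.isClosed_topologicalClosure _).inter (isClopen_setOf_mk U fun y =>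
      (∀ p, p.Prime → p ∣ orderOf y → p ∈ σ) ∧
      ∀ p, p.Prime → p ∣ orderOf (y⁻¹ * (x : G ⧸ U.toSubgroup)) → p ∉ σ).1)
    (fun U => by
      obtain ⟨k, hk⟩ := exists_zpow_primes σ (x : G ⧸ U.toSubgroup)
      exact ⟨x ^ k, zpow_mem (self_mem_closedPowers x) k, hk⟩)
  have ha' := (ha (Classical.arbitrary _)).1
  refine ⟨a, ha', a⁻¹ * x, mul_mem (inv_mem ha') (self_mem_closedPowers x), by simp,
    fun p hp => ?_, Set.disjoint_left.2 fun p hp => ?_⟩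
  · obtain ⟨hp, U, hU⟩ := mem_supp.1 hp
    exact (ha U).2.1 p hp hU
  · obtain ⟨hp, U, hU⟩ := mem_supp.1 hp
    exact (ha U).2.2 p hp hU

end Compact

variable [CompactSpace G]

/-- Makes the `τ`-elements of a pronilpotent subgroup a subgroup, by reduction to finite nilpotent
quotients. -/
lemma supp_mul_subset {A : Subgroup G} (hA : IsPronilpotent A) {x y : G} (hx : x ∈ A)
    (hy : y ∈ A) : supp (x * y) ⊆ supp x ∪ supp y := by
  intro p hpxy
  obtain ⟨hp, U, hU⟩ := mem_supp.1 hpxy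
  by_contra hcon
  rw [Set.mem_union, not_or] at hcon
  have := isNilpotent_map_mk hA U
  have h1 := not_dvd_orderOf_mul_of_isNilpotent hp
    (x := (⟨x, x, hx, rfl⟩ : A.map (QuotientGroup.mk' U.toSubgroup)))
    (y := ⟨y, y, hy, rfl⟩)
    (fun h => hcon.1 (mem_supp.2 ⟨hp, U, by rwa [← Subgroup.orderOf_coe] at h⟩))
    (fun h => hcon.2 (mem_supp.2 ⟨hp, U, by rwa [← Subgroup.orderOf_coe] at h⟩))
  apply h1
  rwa [← Subgroup.orderOf_coe]

/-- The Hall `τ`-subgroup of a pronilpotent subgroup. -/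
def hall (τ : Set ℕ) (A : Subgroup G) (hA : IsPronilpotent A) : Subgroup G where
  carrier := {x | x ∈ A ∧ supp x ⊆ τ}
  mul_mem' hx hy := ⟨mul_mem hx.1 hy.1,
    (supp_mul_subset hA hx.1 hy.1).trans (Set.union_subset hx.2 hy.2)⟩
  one_mem' := ⟨one_mem _, by simp [supp_one]⟩
  inv_mem' hx := ⟨inv_mem hx.1, by simpa [supp_inv] using hx.2⟩

lemma isClosed_hall {τ : Set ℕ} {A : Subgroup G} (hA : IsPronilpotent A)
    (hcl : IsClosed (A : Set G)) : IsClosed (hall τ A hA : Set G) :=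
  hcl.inter (isClosed_setOf_supp_subset τ)

/-- Both halves use Cauchy's theorem in finite quotients. For the index, an element of order `p`
modulo `K` is replaced by its `τ'`-part, its `τ`-part lying in `K`; so `p` divides the order of a
`τ'`-element. -/
lemma isHall_hall (τ : Set ℕ) {A : Subgroup G} (hA : IsPronilpotent A)
    (hcl : IsClosed (A : Set G)) : IsHall τ (hall τ A hA) A where
  isClosed := isClosed_hall hA hcl
  le _ h := h.1
  order := by
    rintro p ⟨hp, U, hU⟩
    have := Fact.mk hp
    rw [card_map_mk] at hU
    obtain ⟨⟨_, x, hx, rfl⟩, ho⟩ := exists_prime_orderOf_dvd_card' p hU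
    refine hx.2 (mem_supp.2 ⟨hp, U, ?_⟩)
    rw [← Subgroup.orderOf_coe] at ho
    exact ho.symm.dvd
  index := by
    refine Set.disjoint_left.2 ?_
    rintro p ⟨hp, U, hU⟩ hpτ
    have := Fact.mk hp
    set K := (hall τ A hA ⊔ U.toSubgroup).subgroupOf A with hK
    have memK : ∀ x : A, x ∈ K ↔ ∃ b ∈ hall τ A hA, ∃ u ∈ U.toSubgroup, b * u = x := by
      intro x
      exact Subgroup.mem_subgroupOf.trans Subgroup.mem_sup_of_normal_right
    have hKn : K.Normal := ⟨fun x hx g => by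
      rw [memK] at hx ⊢
      obtain ⟨b, hb, u, hu, hbu⟩ := hx
      refine ⟨g * b * (g : G)⁻¹, ⟨mul_mem (mul_mem g.2 hb.1) (inv_mem g.2), ?_⟩,
        g * u * (g : G)⁻¹, Subgroup.Normal.conj_mem inferInstance _ hu _, ?_⟩
      · have := supp_conj (g : G)⁻¹ b
        rw [inv_inv] at this
        rw [this]
        exact hb.2
      · simp [← hbu, mul_assoc]⟩
    change p ∣ K.index at hU
    have hfin : Finite (A ⧸ K) := by
      have h1 : U.toSubgroup.FiniteIndex := Subgroup.finiteIndex_of_finite_quotient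
      have h2 : (U.toSubgroup.subgroupOf A).FiniteIndex := inferInstance
      have h3 : U.toSubgroup.subgroupOf A ≤ K := Subgroup.comap_mono le_sup_right
      have : K.FiniteIndex := Subgroup.finiteIndex_of_le h3
      infer_instance
    obtain ⟨y, hy⟩ := exists_prime_orderOf_dvd_card' p hU
    obtain ⟨x, rfl⟩ := QuotientGroup.mk_surjective y
    obtain ⟨b, hb, c, hc, hx, hbτ, hcτ⟩ := exists_mul_eq_of_supp τ (x : G)
    have hbA : b ∈ A := closedPowers_le hcl x.2 hb
    have hcA : c ∈ A := closedPowers_le hcl x.2 hc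
    have hxc : (x : A ⧸ K) = ((⟨c, hcA⟩ : A) : A ⧸ K) := by
      rw [show x = (⟨b, hbA⟩ : A) * ⟨c, hcA⟩ from Subtype.ext hx, QuotientGroup.mk_mul,
        (QuotientGroup.eq_one_iff _).2, one_mul]
      exact (memK _).2 ⟨b, ⟨hbA, hbτ⟩, 1, one_mem _, by simp⟩
    have hdvd : p ∣ orderOf (c : G ⧸ U.toSubgroup) := by
      rw [← hy, hxc]
      apply orderOf_dvd_of_pow_eq_one
      rw [← QuotientGroup.mk_pow, QuotientGroup.eq_one_iff, memK]
      refine ⟨1, one_mem _, c ^ orderOf (c : G ⧸ U.toSubgroup), ?_, by simp⟩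
      rw [← QuotientGroup.eq_one_iff, QuotientGroup.mk_pow, pow_orderOf_eq_one]
    exact Set.disjoint_left.1 hcτ (mem_supp.2 ⟨hp, U, hdvd⟩) hpτ

end Topology

/-! ### Coprime action on finite nilpotent groups -/

section CoprimeAction

/-- All iterates of `z` agree modulo the subgroup of elements `(β v)⁻¹ * v`; hence `z ^ m` is a
partial norm modulo this subgroup. -/
lemma exists_eq_iterate_mul {Z : Type*} [CommGroup Z] (β : Z →* Z) (z : Z) (m : ℕ) :
    ∃ v, z = β^[m] z * ((β v)⁻¹ * v) := by
  induction m with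
  | zero => exact ⟨1, by simp⟩
  | succ m ih =>
    obtain ⟨v, hv⟩ := ih
    refine ⟨v * β^[m] z, ?_⟩
    rw [Function.iterate_succ_apply', map_mul]
    nth_rewrite 1 [hv]
    generalize β^[m] z = y
    simp only [mul_inv]
    rw [show β y * ((β v)⁻¹ * (β y)⁻¹ * (v * y)) = (β y * (β y)⁻¹) * (y * ((β v)⁻¹ * v)) by
      simp only [mul_assoc, mul_comm, mul_left_comm], mul_inv_cancel, one_mul]

lemma exists_pow_eq_prod_iterate_mul {Z : Type*} [CommGroup Z] (β : Z →* Z) (z : Z) (m : ℕ) :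
    ∃ w, z ^ m = (∏ i ∈ Finset.range m, β^[i] z) * ((β w)⁻¹ * w) := by
  induction m with
  | zero => exact ⟨1, by simp⟩
  | succ m ih =>
    obtain ⟨w, hw⟩ := ih
    obtain ⟨v, hv⟩ := exists_eq_iterate_mul β z m
    refine ⟨w * v, ?_⟩
    rw [pow_succ, hw, Finset.prod_range_succ]
    nth_rewrite 2 [hv]
    simp only [map_mul, mul_inv, mul_assoc, mul_comm, mul_left_comm]

variable {Z : Type*} [CommGroup Z] {β : Z →* Z} {n : ℕ}

lemma exists_pow_eq_of_coprime (hc : n.Coprime (Nat.card Z)) (z : Z) : ∃ y, y ^ n = z :=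
  (powCoprime hc.symm).surjective z

/-- Write `z = y ^ n`. As `n`-th powers are injective, `y` also has trivial norm, so `y ^ n` has the
required form. -/
lemma exists_eq_of_prod_iterate_eq_one (hc : n.Coprime (Nat.card Z)) {z : Z}
    (hz : ∏ i ∈ Finset.range n, β^[i] z = 1) : ∃ w, z = (β w)⁻¹ * w := by
  obtain ⟨y, rfl⟩ := exists_pow_eq_of_coprime hc z
  obtain ⟨w, hw⟩ := exists_pow_eq_prod_iterate_mul β y n
  refine ⟨w, ?_⟩
  have : (∏ i ∈ Finset.range n, β^[i] y) ^ n = 1 ^ n := by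
    rw [one_pow, ← hz, ← Finset.prod_pow]
    exact Finset.prod_congr rfl fun i _ => (iterate_map_pow β i y n).symm
  have : ∏ i ∈ Finset.range n, β^[i] y = 1 := (powCoprime hc.symm).injective this
  rw [hw, this, one_mul]

lemma exists_fixed_mul_of_comm (hβ : ∀ z, β^[n] z = z) (hc : n.Coprime (Nat.card Z)) (z : Z) :
    ∃ c w, β c = c ∧ z = c * ((β w)⁻¹ * w) := by
  obtain ⟨y, rfl⟩ := exists_pow_eq_of_coprime hc z
  obtain ⟨w, hw⟩ := exists_pow_eq_prod_iterate_mul β y n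
  refine ⟨_, w, ?_, hw⟩
  rw [map_prod]
  have h1 := Finset.prod_range_succ (fun i => β^[i] y) n
  rw [Finset.prod_range_succ', hβ] at h1
  simpa [Function.iterate_succ_apply'] using h1

open scoped IsMulCommutative in
/-- A coprime automorphism `α` of a finite nilpotent group `H` satisfies `H = C_H(α) [H, α]`, and
every element of `H` has the form `c (α k)⁻¹ k` with `c` fixed by `α`. -/
lemma exists_fixed_mul {H : Type*} [Group H] [Group.IsNilpotent H] {n : ℕ} (α : H →* H)
    (hα : ∀ h, α^[n] h = h) (hc : n.Coprime (Nat.card H)) (h : H) :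
    ∃ c k, α c = c ∧ h = c * ((α k)⁻¹ * k) := by
  revert α h
  refine Group.nilpotent_center_quotient_ind (P := fun H _ _ => n.Coprime (Nat.card H) →
    ∀ α : H →* H, (∀ h, α^[n] h = h) → ∀ h : H, ∃ c k, α c = c ∧ h = c * ((α k)⁻¹ * k))
    H ?_ ?_ hc
  · intro H _ _ _ α _ h
    exact ⟨1, 1, map_one _, Subsingleton.elim _ _⟩
  · clear hc
    intro H _ _ ih hc α hα h
    rcases Nat.eq_zero_or_pos n with rfl | hn
    · rw [Nat.coprime_zero_left] at hc
      have := (Nat.card_eq_one_iff_unique.1 hc).1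
      exact ⟨1, 1, map_one _, Subsingleton.elim _ _⟩
    have hsurj : Function.Surjective α := fun y => ⟨α^[n - 1] y, by
      rw [← Function.iterate_succ_apply' α, Nat.succ_eq_add_one, Nat.sub_add_cancel hn, hα]⟩
    have hZ : ∀ z ∈ Subgroup.center H, α z ∈ Subgroup.center H := by
      intro z hz
      rw [Subgroup.mem_center_iff] at hz ⊢
      intro y
      obtain ⟨y, rfl⟩ := hsurj y
      rw [← map_mul, hz, map_mul]
    let β : Subgroup.center H →* Subgroup.center H :=
      (α.comp (Subgroup.center H).subtype).codRestrict (Subgroup.center H) fun z => hZ z z.2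
    have hβ : ∀ z, ((β z : Subgroup.center H) : H) = α z := fun z => rfl
    have hβi : ∀ i z, ((β^[i] z : Subgroup.center H) : H) = α^[i] z := by
      intro i z
      induction i with
      | zero => rfl
      | succ i ih => rw [Function.iterate_succ_apply', Function.iterate_succ_apply', hβ, ih]
    have hcZ : n.Coprime (Nat.card (Subgroup.center H)) :=
      hc.coprime_dvd_right (Subgroup.card_subgroup_dvd_card _)
    have hcQ : n.Coprime (Nat.card (H ⧸ Subgroup.center H)) :=
      hc.coprime_dvd_right (Subgroup.card_quotient_dvd_card _)
    let γ := QuotientGroup.map (Subgroup.center H) (Subgroup.center H) α hZ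
    have hγ : ∀ y : H ⧸ Subgroup.center H, γ^[n] y = y := by
      intro y
      obtain ⟨y, rfl⟩ := QuotientGroup.mk_surjective y
      have : ∀ i, γ^[i] (y : H ⧸ Subgroup.center H) = (α^[i] y : H) := by
        intro i
        induction i with
        | zero => rfl
        | succ i ih => rw [Function.iterate_succ_apply', Function.iterate_succ_apply', ih]; rfl
      rw [this, hα]
    obtain ⟨c', k', hc', hk'⟩ := ih hcQ γ hγ h
    obtain ⟨c, rfl⟩ := QuotientGroup.mk_surjective c'
    obtain ⟨k, rfl⟩ := QuotientGroup.mk_surjective k'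
    have hc1 : c⁻¹ * α c ∈ Subgroup.center H := QuotientGroup.eq.1 hc'.symm
    have hk1 : (c * ((α k)⁻¹ * k))⁻¹ * h ∈ Subgroup.center H := QuotientGroup.eq.1 hk'.symm
    obtain ⟨z₁, hz₁⟩ : ∃ z : Subgroup.center H, (z : H) = c⁻¹ * α c := ⟨⟨_, hc1⟩, rfl⟩
    obtain ⟨z, hz⟩ : ∃ z : Subgroup.center H, (z : H) = (c * ((α k)⁻¹ * k))⁻¹ * h := ⟨⟨_, hk1⟩, rfl⟩
    -- Since `α^[n] c = c`, the norm of `z₁` is trivial. Hence `z₁ = (α w)⁻¹ * w` with `w` central,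
    -- and `c * w` is fixed by `α`.
    have hprod : ∀ m, α^[m] c = c * ((∏ i ∈ Finset.range m, β^[i] z₁ : Subgroup.center H) : H) := by
      intro m
      induction m with
      | zero => simp
      | succ m ihm =>
        rw [Function.iterate_succ_apply', ihm, map_mul, Finset.prod_range_succ', ← hβ, map_prod]
        simp only [Function.iterate_succ_apply', Function.iterate_zero, id, Subgroup.coe_mul]
        rw [Subgroup.mem_center_iff.1 z₁.2, hz₁]
        group
    have hone : ∏ i ∈ Finset.range n, β^[i] z₁ = 1 := by
      have := hprod n
      rw [hα] at this
      exact Subtype.ext (by simpa using this)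
    obtain ⟨w, hw⟩ := exists_eq_of_prod_iterate_eq_one hcZ hone
    -- The central remainder is `w⁻¹ * z`, because `c` has been replaced by `c * w`.
    obtain ⟨c₂, v, hc₂, hv⟩ := exists_fixed_mul_of_comm
      (fun z => Subtype.ext ((hβi n z).trans (hα z))) hcZ (w⁻¹ * z)
    have ew : α c = c * ((α w)⁻¹ * w) := by
      have := congrArg (Subtype.val) hw
      rw [hz₁] at this
      rw [← hβ, ← inv_mul_eq_iff_eq_mul, this]
      rfl
    have ez : ((w : H)⁻¹ * z) = c₂ * ((α v)⁻¹ * v) := congrArg Subtype.val hv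
    have hwc := Subgroup.mem_center_iff.1 w.2
    have hvc := Subgroup.mem_center_iff.1 v.2
    have hc₂c := Subgroup.mem_center_iff.1 c₂.2
    have hαwc := Subgroup.mem_center_iff.1 (hZ w w.2)
    have hαvc := Subgroup.mem_center_iff.1 (inv_mem (hZ v v.2))
    refine ⟨c * w * c₂, k * v, ?_, ?_⟩
    · have e : ((α w)⁻¹ * w) * α w = w := by rw [mul_assoc, hαwc, inv_mul_cancel_left]
      rw [map_mul, map_mul, ew, show α c₂ = c₂ from congrArg Subtype.val hc₂, mul_assoc c, e]
    · have e1 : h = c * ((α k)⁻¹ * k) * z := by rw [hz]; group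
      have e2 : (z : H) = w * (c₂ * ((α v)⁻¹ * v)) := by rw [← ez]; group
      rw [e1, e2, map_mul, mul_inv_rev]
      have e3 : c * ((α k)⁻¹ * k) * (w * (c₂ * ((α v)⁻¹ * v)))
        = c * (((α k)⁻¹ * k) * w) * (c₂ * ((α v)⁻¹ * v)) := by group
      rw [e3, hwc]
      have e4 : c * (w * ((α k)⁻¹ * k)) * (c₂ * ((α v)⁻¹ * v))
        = c * w * ((((α k)⁻¹ * k)) * c₂) * ((α v)⁻¹ * v) := by group
      rw [e4, hc₂c]
      have e5 : c * w * (c₂ * ((α k)⁻¹ * k)) * ((α v)⁻¹ * v)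
        = c * w * c₂ * ((((α k)⁻¹ * k)) * (α v)⁻¹ * v) := by group
      rw [e5, hαvc]
      group

end CoprimeAction

/-! ### Coprime commutators are `δ*`-values -/

section Profinite

variable {G : Type u} [Group G] [TopologicalSpace G] [IsTopologicalGroup G]

lemma isDeltaStarValue_of_succ {k : ℕ} {x : G} (h : IsDeltaStarValue (k + 1) x) :
    IsDeltaStarValue k x := by
  induction k generalizing x with
  | zero => trivial
  | succ k ih =>
    obtain ⟨b, c, y, z, hb, hc, hy, hz, hyz, rfl⟩ := h
    exact ⟨b, c, y, z, ih hb, ih hc, hy, hz, hyz, rfl⟩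

variable [CompactSpace G] [TotallyDisconnectedSpace G]

lemma eq_of_forall_mk_eq {a b : G}
    (h : ∀ U : OpenNormalSubgroup G, (a : G ⧸ U.toSubgroup) = b) : a = b := by
  by_contra hne
  obtain ⟨U, hU⟩ := ProfiniteGrp.exist_openNormalSubgroup_sub_open_nhds_of_one
    (isOpen_compl_singleton (x := a⁻¹ * b)) (by simpa [eq_comm, inv_mul_eq_one] using hne)
  exact hU (QuotientGroup.eq.1 (h U)) rfl

/-- If `x` normalizes `A` and acts coprimely on the powers of `h ∈ A`, then
`[x, h] = [x, [x, k]]` for some `k ∈ A`. -/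
lemma exists_comm_comm_eq {A : Subgroup G} (hcl : IsClosed (A : Set G)) (hA : IsPronilpotent A)
    {x h : G} (hx : ∀ a ∈ A, x⁻¹ * a * x ∈ A) (hh : h ∈ A) (hxh : CoprimeOrders x h) :
    ∃ k ∈ A, supp k ⊆ supp h ∧ comm x h = comm x (comm x k) := by
  let H := hall (supp h) A hA
  have hxH : ∀ a ∈ H, x⁻¹ * a * x ∈ H := fun a ha => ⟨hx a ha.1, by rw [supp_conj]; exact ha.2⟩
  obtain ⟨k, hk⟩ := exists_forall_mem_of_antitone
    (fun U : OpenNormalSubgroup G => (H : Set G) ∩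
      {k | comm (x : G ⧸ U.toSubgroup) h = comm (x : G ⧸ U.toSubgroup) (comm (x : G ⧸ U.toSubgroup) k)})
    (fun U V hUV k hk => ⟨hk.1, congrArg
      (QuotientGroup.map U.toSubgroup V.toSubgroup (MonoidHom.id G) hUV) hk.2⟩)
    (fun U => (isClosed_hall hA hcl).inter (isClopen_setOf_mk U fun y =>
      comm (x : G ⧸ U.toSubgroup) h = comm (x : G ⧸ U.toSubgroup) (comm (x : G ⧸ U.toSubgroup) y)).1)
    (fun U => by
      set N := H.map (QuotientGroup.mk' U.toSubgroup)
      have hN : Group.IsNilpotent N := by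
        have := isNilpotent_map_mk hA U
        have hle : N ≤ A.map (QuotientGroup.mk' U.toSubgroup) :=
          Subgroup.map_mono fun _ h => h.1
        exact Subgroup.isNilpotent_of_ker_le_center (Subgroup.inclusion hle) (by
          rw [(MonoidHom.ker_eq_bot_iff _).2 (Subgroup.inclusion_injective hle)]
          exact bot_le)
      have hα : ∀ y : N, (x : G ⧸ U.toSubgroup)⁻¹ * y * (x : G ⧸ U.toSubgroup) ∈ N := by
        rintro ⟨_, a, ha, rfl⟩
        exact ⟨_, hxH a ha, rfl⟩
      let α : N →* N := (((MulAut.conj (x : G ⧸ U.toSubgroup)⁻¹).toMonoidHom).comp N.subtype).codRestrict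
        N fun y => by simpa using hα y
      have hαc : ∀ y : N, (α y : G ⧸ U.toSubgroup)
          = (x : G ⧸ U.toSubgroup)⁻¹ * y * (x : G ⧸ U.toSubgroup) := fun y => by simp [α]
      have hαi : ∀ y : N, α^[orderOf (x : G ⧸ U.toSubgroup)] y = y := by
        intro y
        have : ∀ i, (α^[i] y : G ⧸ U.toSubgroup)
            = ((x : G ⧸ U.toSubgroup) ^ i)⁻¹ * y * (x : G ⧸ U.toSubgroup) ^ i := by
          intro i
          induction i with
          | zero => simp
          | succ i ih => rw [Function.iterate_succ_apply', hαc, ih, pow_succ]; group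
        apply Subtype.ext
        rw [this, pow_orderOf_eq_one]
        simp
      have hcop : (orderOf (x : G ⧸ U.toSubgroup)).Coprime (Nat.card N) := by
        refine Nat.coprime_of_dvd fun p hp h1 h2 => ?_
        have hpH : p ∈ primesOf H := ⟨hp, U, by rwa [card_map_mk]⟩
        exact Set.disjoint_left.1 hxh (mem_supp.2 ⟨hp, U, h1⟩)
          ((isHall_hall (supp h) hA hcl).order hpH)
      -- Modulo `U` this reads `h = c [x, k]` with `c` centralized by `x`.
      obtain ⟨c, k, hc, hk⟩ := exists_fixed_mul α hαi hcop ⟨h, h, ⟨hh, le_rfl⟩, rfl⟩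
      obtain ⟨k₀, hk₀, hk₁⟩ := k.2
      refine ⟨k₀, hk₀, ?_⟩
      have hk₁ : (k₀ : G ⧸ U.toSubgroup) = k := hk₁
      have hc1 : comm (x : G ⧸ U.toSubgroup) c = 1 := by
        have := congrArg Subtype.val hc
        rw [hαc] at this
        have e : comm (x : G ⧸ U.toSubgroup) c
            = ((x : G ⧸ U.toSubgroup)⁻¹ * c * (x : G ⧸ U.toSubgroup))⁻¹ * c := by
          simp only [comm]; group
        rw [e, this, inv_mul_cancel]
      have hh1 : (h : G ⧸ U.toSubgroup) = c * comm (x : G ⧸ U.toSubgroup) k := by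
        have := congrArg Subtype.val hk
        simp only [Subgroup.coe_mul, Subgroup.coe_inv, hαc] at this
        rw [this]
        simp only [comm]
        group
      change comm (x : G ⧸ U.toSubgroup) h = comm (x : G ⧸ U.toSubgroup) (comm (x : G ⧸ U.toSubgroup) k₀)
      rw [hh1, comm_mul_right, hc1, hk₁]
      group)
  refine ⟨k, (hk (Classical.arbitrary _)).1.1, (hk (Classical.arbitrary _)).1.2, ?_⟩
  exact eq_of_forall_mk_eq fun U => (hk U).2

/-- In the inductive step `[x, h] = [x, [x, k]]`, where both `x` and, by induction, `[x, k]` have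
level `j + 1`. They are coprime because `[x, k]` is a product of a conjugate of `k⁻¹` and `k` inside
`A`. -/
lemma isDeltaStarValue_comm {A : Subgroup G} (hcl : IsClosed (A : Set G)) (hA : IsPronilpotent A)
    {j : ℕ} {x h : G} (hxd : IsDeltaStarValue j x) (hx : ∀ a ∈ A, x⁻¹ * a * x ∈ A) (hh : h ∈ A)
    (hxh : CoprimeOrders x h) : IsDeltaStarValue (j + 1) (comm x h) := by
  induction j generalizing h with
  | zero => exact ⟨x, h, x, h, trivial, trivial, self_mem_closedPowers x,
      self_mem_closedPowers h, hxh, rfl⟩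
  | succ j ih =>
    obtain ⟨k, hk, hks, he⟩ := exists_comm_comm_eq hcl hA hx hh hxh
    have hxk : CoprimeOrders x k := Disjoint.mono_right hks hxh
    refine ⟨x, comm x k, x, comm x k, hxd, ih (isDeltaStarValue_of_succ hxd) hk hxk,
      self_mem_closedPowers _, self_mem_closedPowers _, ?_, he⟩
    have e : comm x k = x⁻¹ * k⁻¹ * x * k := rfl
    refine Disjoint.mono_right (b := supp (comm x k)) ?_ hxk
    rw [e]
    refine (supp_mul_subset hA (hx _ (inv_mem hk)) hk).trans ?_
    rw [supp_conj, supp_inv, Set.union_self]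
    exact le_rfl

lemma isDeltaStarValue_seqComm {A : ℕ → Subgroup G} (hcl : ∀ i, IsClosed (A i : Set G))
    (hA : ∀ i, IsPronilpotent (A i)) (hchain : NormalizingChain A) {g : ℕ → G}
    (hg : ∀ i, g i ∈ A i) (hcop : ∀ i, CoprimeOrders (g i) (g (i + 1))) (k : ℕ) :
    IsDeltaStarValue k (seqComm g k) ∧ seqComm g k ∈ A k ∧ supp (seqComm g k) ⊆ supp (g k) := by
  induction k with
  | zero => exact ⟨trivial, hg 0, le_rfl⟩
  | succ k ih =>
    obtain ⟨h1, h2, h3⟩ := ih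
    have hx := hchain (k + 1) k (by omega) _ h2
    refine ⟨isDeltaStarValue_comm (hcl _) (hA (k + 1)) h1 hx (hg _)
      (Disjoint.mono_left h3 (hcop k)), hchain.comm_mem h2 (hg _), ?_⟩
    change supp ((seqComm g k)⁻¹ * (g (k + 1))⁻¹ * seqComm g k * g (k + 1)) ⊆ _
    refine (supp_mul_subset (hA (k + 1)) (hx _ (inv_mem (hg _))) (hg _)).trans ?_
    rw [supp_conj, supp_inv, Set.union_self]

end Profinite

/-! ### Small closed sets have isolated points -/

section Cardinality

variable {X : Type u} [TopologicalSpace X] [CompactSpace X] [TotallySeparatedSpace X]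

/-- A nonempty closed subset without isolated points of a profinite space contains a copy of the
Cantor set. -/
lemma exists_injective_of_no_isolated {Y : Set X} (hY : IsClosed Y) (hne : Y.Nonempty)
    (hiso : ∀ y ∈ Y, ∀ O : Set X, IsOpen O → y ∈ O → ∃ z ∈ O ∩ Y, z ≠ y) :
    ∃ F : (ℕ → Bool) → X, Function.Injective F ∧ ∀ f, F f ∈ Y := by
  let Piece := {K : Set X // IsClopen K ∧ (K ∩ Y).Nonempty}
  have hsplit : ∀ K : Piece, ∃ s : Bool → Piece,
      (∀ b, (s b : Set X) ⊆ K) ∧ Disjoint (s true : Set X) (s false) := by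
    rintro ⟨K, hK, y, hyK, hyY⟩
    obtain ⟨z, ⟨hzK, hzY⟩, hzy⟩ := hiso y hyY K hK.2 hyK
    obtain ⟨W, hW, hyW, hzW⟩ := exists_isClopen_of_totally_separated hzy.symm
    refine ⟨fun b => match b with
      | true => ⟨K ∩ W, hK.inter hW, y, ⟨hyK, hyW⟩, hyY⟩
      | false => ⟨K ∩ Wᶜ, hK.inter hW.compl, z, ⟨hzK, hzW⟩, hzY⟩, ?_, ?_⟩
    · rintro (_ | _)
      · exact Set.inter_subset_left
      · exact Set.inter_subset_left
    · exact Set.disjoint_left.2 fun x h1 h2 => h2.2 h1.2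
  choose s hs hdisj using hsplit
  -- The pieces along the branch `f` of a binary tree of clopen sets meeting `Y`.
  let D : (ℕ → Bool) → ℕ → Piece := fun f n =>
    Nat.rec ⟨Set.univ, isClopen_univ, by simpa using hne⟩ (fun n K => s K (f n)) n
  have hD : ∀ f n, D f (n + 1) = s (D f n) (f n) := fun f n => rfl
  have hpt : ∀ f, ∃ x, ∀ n, x ∈ (D f n).1 ∩ Y := by
    intro f
    obtain ⟨x, hx⟩ := IsCompact.nonempty_iInter_of_sequence_nonempty_isCompact_isClosed
      (fun n => (D f n).1 ∩ Y)
      (fun n => Set.inter_subset_inter_left _ (by rw [hD]; exact hs _ _))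
      (fun n => (D f n).2.2) ((D f 0).2.1.1.inter hY).isCompact
      (fun n => (D f n).2.1.1.inter hY)
    exact ⟨x, Set.mem_iInter.1 hx⟩
  choose F hF using hpt
  refine ⟨F, fun f g hfg => ?_, fun f => (hF f 0).2⟩
  have key : ∀ n, (∀ i < n, f i = g i) → D f n = D g n := by
    intro n
    induction n with
    | zero => exact fun _ => rfl
    | succ n ih => intro h; rw [hD, hD, ih fun i hi => h i (by omega), h n (by omega)]
  -- At the first place where `f` and `g` differ, the common point would lie in two disjoint pieces.
  funext n
  induction n using Nat.strong_induction_on with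
  | _ n ih =>
    by_contra hn
    have h1 := (hF f (n + 1)).1
    have h2 := (hF g (n + 1)).1
    rw [hD] at h1 h2
    rw [← hfg, ← key n ih] at h2
    generalize f n = a at h1 hn
    generalize g n = b at h2 hn
    cases a <;> cases b
    · exact hn rfl
    · exact Set.disjoint_left.1 (hdisj _) h2 h1
    · exact Set.disjoint_left.1 (hdisj _) h1 h2
    · exact hn rfl

lemma exists_isolated_of_mk_lt {Y : Set X} (hY : IsClosed Y) (hne : Y.Nonempty)
    (hcard : Cardinal.mk Y < 2 ^ Cardinal.aleph0) :
    ∃ y ∈ Y, ∃ O : Set X, IsOpen O ∧ y ∈ O ∧ ∀ z ∈ O ∩ Y, z = y := by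
  by_contra! hcon
  obtain ⟨F, hinj, hF⟩ := exists_injective_of_no_isolated hY hne fun y hy O hO hyO =>
    hcon y hy O hO hyO
  have := Cardinal.lift_mk_le_lift_mk_of_injective (α := ℕ → Bool) (β := Y)
    (f := fun f => ⟨F f, hF f⟩) fun f g h => hinj (congrArg Subtype.val h)
  refine absurd hcard (not_lt.2 ?_)
  simpa using this

/-- A continuous map with few values on a nonempty compact set is constant on a nonempty relatively
open subset. -/
lemma exists_const_on_open {Z : Type*} [TopologicalSpace Z] {C : Set Z} (hC : IsCompact C)
    (hne : C.Nonempty) {f : Z → X} (hf : Continuous f)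
    (hcard : Cardinal.mk (f '' C) < 2 ^ Cardinal.aleph0) :
    ∃ a ∈ C, ∃ O : Set Z, IsOpen O ∧ a ∈ O ∧ ∀ z ∈ O ∩ C, f z = f a := by
  obtain ⟨_, ⟨a, ha, rfl⟩, O, hO, haO, h⟩ :=
    exists_isolated_of_mk_lt (hC.image hf).isClosed (hne.image f) hcard
  exact ⟨a, ha, f ⁻¹' O, hO.preimage hf, haO, fun z hz => h _ ⟨hz.1, z, hz.2, rfl⟩⟩

end Cardinality

/-! ### Open normal subgroups and closed normal closures -/

lemma bigSet_mono_right {G : Type u} [Group G] {A : ℕ → Subgroup G} {U V : Subgroup G} (h : U ≤ V) (J : Set ℕ) (i : ℕ) :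
    bigSet A U J i ⊆ bigSet A V J i :=
  fun _ hx => ⟨hx.1, fun hi => h (hx.2 hi)⟩

lemma exists_le_forall {G : Type u} [Group G] [TopologicalSpace G] {ι : Type*} [Finite ι] (V : ι → OpenNormalSubgroup G) :
    ∃ U, ∀ i, U ≤ V i := by
  have := Fintype.ofFinite ι
  have : ∀ s : Finset ι, ∃ U, ∀ i ∈ s, U ≤ V i := by
    classical
    intro s
    induction s using Finset.induction_on with
    | empty => exact ⟨Classical.arbitrary _, by simp⟩
    | insert a s _ ih =>
      obtain ⟨U, hU⟩ := ih
      refine ⟨U ⊓ V a, fun i hi => ?_⟩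
      rcases Finset.mem_insert.1 hi with rfl | hi
      · exact inf_le_right
      · exact inf_le_left.trans (hU i hi)
  obtain ⟨U, hU⟩ := this Finset.univ
  exact ⟨U, fun i => hU i (Finset.mem_univ i)⟩

section Closure

variable {G : Type u} [Group G] [TopologicalSpace G] [IsTopologicalGroup G]

instance normal_closedNormalClosure (S : Set G) : (closedNormalClosure S).Normal :=
  Subgroup.is_normal_topologicalClosure _

lemma subset_closedNormalClosure (S : Set G) : S ⊆ closedNormalClosure S :=
  Subgroup.subset_normalClosure.trans (Subgroup.le_topologicalClosure _)

lemma closedNormalClosure_mono {S T : Set G} (h : S ⊆ T) :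
    closedNormalClosure S ≤ closedNormalClosure T :=
  Subgroup.topologicalClosure_mono (Subgroup.normalClosure_mono h)

lemma continuous_seqComm (n : ℕ) : Continuous fun g : ℕ → G => seqComm g n := by
  induction n with
  | zero => exact continuous_apply 0
  | succ n ih =>
    simp only [seqComm, comm]
    fun_prop

end Closure

/-! ### Prime patterns and the construction of `W` -/

section Patterns

variable {G : Type u} [Group G] [TopologicalSpace G] [IsTopologicalGroup G] [CompactSpace G]

lemma exists_openNormalSubgroup_pi [TotallyDisconnectedSpace G] {O : Set (ℕ → G)} (hO : IsOpen O)
    {a : ℕ → G} (ha : a ∈ O) :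
    ∃ V : OpenNormalSubgroup G, ∀ z : ℕ → G, (∀ i, (a i)⁻¹ * z i ∈ V.toSubgroup) → z ∈ O := by
  obtain ⟨s, u, hu, hs⟩ := isOpen_pi_iff.1 hO a ha
  have : ∀ i : s, ∃ V : OpenNormalSubgroup G, ∀ x ∈ V.toSubgroup, a i * x ∈ u i := by
    intro i
    obtain ⟨V, hV⟩ := ProfiniteGrp.exist_openNormalSubgroup_sub_open_nhds_of_one
      ((hu i i.2).1.preimage (continuous_const_mul (a i))) (by simpa using (hu i i.2).2)
    exact ⟨V, fun x hx => hV hx⟩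
  choose V hV using this
  obtain ⟨U, hU⟩ := exists_le_forall V
  refine ⟨U, fun z hz => hs fun i hi => ?_⟩
  simpa using hV ⟨i, hi⟩ _ (hU ⟨i, hi⟩ (hz i))

lemma hall_mono {τ τ' : Set ℕ} (h : τ ⊆ τ') {A : Subgroup G} (hA : IsPronilpotent A) :
    hall τ A hA ≤ hall τ' A hA :=
  fun _ hx => ⟨hx.1, hx.2.trans h⟩

/-- A sequence of sets of primes which agrees with `π` outside `I`, whose terms indexed by `I`
avoid `σ`, and in which consecutive terms are disjoint. -/
structure IsPattern (I : Set ℕ) (π : ℕ → Set ℕ) (σ : Set ℕ) (τ : ℕ → Set ℕ) : Prop where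
  eq : ∀ i ∉ I, τ i = π i
  avoids : ∀ i ∈ I, Disjoint (τ i) σ
  disjoint : ∀ i, Disjoint (τ i) (τ (i + 1))

lemma IsPattern.anti {I : Set ℕ} {π τ : ℕ → Set ℕ} {σ σ' : Set ℕ} (h : IsPattern I π σ' τ)
    (hσ : σ ⊆ σ') : IsPattern I π σ τ :=
  ⟨h.eq, fun i hi => (h.avoids i hi).mono_right hσ, h.disjoint⟩

/-- Enlarging the terms indexed by `I` of a pattern by the supports of a coprime sequence. -/
lemma IsPattern.union {I : Set ℕ} {π τ s : ℕ → Set ℕ} {σ₀ σ₁ σ₂ : Set ℕ}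
    (h : IsPattern I π σ₂ τ) (hπ : ∀ i, π i ⊆ σ₀) (h₀₁ : σ₀ ⊆ σ₁) (h₁₂ : σ₁ ⊆ σ₂)
    (hs₂ : ∀ i ∈ I, s i ⊆ σ₂) (hs₁ : ∀ i ∈ I, Disjoint (s i) σ₁)
    (hs : ∀ i, Disjoint (s i) (s (i + 1))) (hsI : ∀ i ∉ I, s i ⊆ π i) :
    IsPattern I π σ₁ fun i => τ i ∪ s i := by
  refine ⟨fun i hi => ?_, fun i hi => ?_, fun i => ?_⟩
  · rw [h.eq i hi, Set.union_eq_left.2 (hsI i hi)]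
  · exact Set.disjoint_union_left.2 ⟨(h.avoids i hi).mono_right h₁₂, hs₁ i hi⟩
  · have key : ∀ i j, Disjoint (τ i) (τ j) → Disjoint (s i) (s j) → Disjoint (τ i) (s j) := by
      intro i j h1 h2
      by_cases hj : j ∈ I
      · by_cases hi : i ∈ I
        · exact (h.avoids i hi).mono_right (hs₂ j hj)
        · rw [h.eq i hi]
          exact ((hs₁ j hj).mono_right ((hπ i).trans h₀₁)).symm
      · exact h1.mono_right ((hsI j hj).trans (h.eq j hj).ge)
    rw [Set.disjoint_union_left, Set.disjoint_union_right, Set.disjoint_union_right]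
    exact ⟨⟨h.disjoint i, key _ _ (h.disjoint i) (hs i)⟩,
      (key _ _ (h.disjoint i).symm (hs i).symm).symm, hs i⟩

variable {A : ℕ → Subgroup G}

lemma NormalizingChain.conj_mem_hall (hchain : NormalizingChain A) (hA : ∀ i, IsPronilpotent (A i))
    (τ : ℕ → Set ℕ) (i j : ℕ) (hji : j ≤ i) (a : G) (ha : a ∈ A j) (s : G)
    (hs : s ∈ hall (τ i) (A i) (hA i)) : a⁻¹ * s * a ∈ hall (τ i) (A i) (hA i) :=
  ⟨hchain i j hji a ha s hs.1, by rw [supp_conj]; exact hs.2⟩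

lemma NormalizingChain.hall (hchain : NormalizingChain A) (hA : ∀ i, IsPronilpotent (A i))
    (τ : ℕ → Set ℕ) : NormalizingChain fun i => hall (τ i) (A i) (hA i) :=
  fun i j hji a ha => hchain.conj_mem_hall hA τ i j hji a ha.1

/-- The sequences with terms in the given subgroups and consecutive terms of coprime orders. -/
def coprimeSeqs (A : ℕ → Subgroup G) : Set (ℕ → G) :=
  {g | (∀ i, g i ∈ A i) ∧ ∀ i, CoprimeOrders (g i) (g (i + 1))}

/-- One value `w` settles all entries from prescribed cosets `b i U`, `i ∈ J`. The commutator map is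
constant near some `a` in the compact set `X`. Once `a` is truncated to finitely many primes at `I`
(for finite `σ₀`), Hall elements for a pattern avoiding these primes can be multiplied onto it
without losing coprimality, so `seqComm_mem_of_finalSet` applies. -/
lemma exists_normalClosure_coset [TotallyDisconnectedSpace G]
    (hcl : ∀ i, IsClosed (A i : Set G)) (hA : ∀ i, IsPronilpotent (A i))
    (hchain : NormalizingChain A) {n : ℕ}
    (hcard : Cardinal.mk {a : G // IsDeltaStarValue n a} < 2 ^ Cardinal.aleph0)
    {I : Set ℕ} {π : ℕ → Set ℕ} {σ₀ : Set ℕ} (hπσ : ∀ i, π i ⊆ σ₀)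
    (hπ : ∀ i, i ∉ I → i + 1 ∉ I → Disjoint (π i) (π (i + 1)))
    {J : Set ℕ} (hJI : ∀ i ∈ J, i ∉ I) (U : OpenNormalSubgroup G) (W : Set G)
    (hW : ∀ τ, IsPattern I π (σ₀ ∪ indexPrimes U) τ → ∀ j ∈ J, ∀ g : ℕ → G,
      (∀ i ≤ n, g i ∈ bigSet (fun i => hall (τ i) (A i) (hA i)) U.toSubgroup (J \ {j}) i) →
      seqComm g n ∈ closedNormalClosure W)
    (b : ℕ → G) (hb : ∀ i ∈ J, b i ∈ hall (π i) (A i) (hA i)) :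
    ∃ V : OpenNormalSubgroup G, V ≤ U ∧ ∃ w ∈ (seqComm · n) '' coprimeSeqs A,
      ∀ τ, IsPattern I π (σ₀ ∪ indexPrimes V) τ → ∀ g : ℕ → G,
        (∀ i ≤ n, g i ∈ hall (τ i) (A i) (hA i) ∧ (i ∈ J → (b i)⁻¹ * g i ∈ U.toSubgroup) ∧
          (i ∉ J → g i ∈ V.toSubgroup)) →
        seqComm g n ∈ closedNormalClosure (W ∪ {w}) := by
  have hUcl : IsClosed (U.toSubgroup : Set G) := U.toOpenSubgroup.isClosed
  let Y : ℕ → Set G := fun i => {x | (i ∈ J → x = b i) ∧ (i ∉ J → x ∈ A i ∧ x ∈ U.toSubgroup ∧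
    (i ∉ I → supp x ⊆ π i) ∧ (i ∈ I → supp x ⊆ (σ₀ ∪ indexPrimes U)ᶜ))}
  have hYcl : ∀ i, IsClosed (Y i) := by
    intro i
    by_cases hJ : i ∈ J
    · have : Y i = {b i} := by ext x; simp [Y, hJ]
      rw [this]
      exact isClosed_singleton
    · by_cases hI : i ∈ I
      · have : Y i = (A i : Set G) ∩ ((U.toSubgroup : Set G) ∩ {x | supp x ⊆ (σ₀ ∪ indexPrimes U)ᶜ}) := by
          ext x; simp [Y, hJ, hI]
        rw [this]
        exact (hcl i).inter (hUcl.inter (isClosed_setOf_supp_subset _))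
      · have : Y i = (A i : Set G) ∩ ((U.toSubgroup : Set G) ∩ {x | supp x ⊆ π i}) := by
          ext x; simp [Y, hJ, hI]
        rw [this]
        exact (hcl i).inter (hUcl.inter (isClosed_setOf_supp_subset _))
  have hYA : ∀ i, ∀ x ∈ Y i, x ∈ A i := by
    intro i x hx
    by_cases hJ : i ∈ J
    · rw [hx.1 hJ]; exact (hb i hJ).1
    · exact (hx.2 hJ).1
  have hYπ : ∀ i ∉ I, ∀ x ∈ Y i, supp x ⊆ π i := by
    intro i hI x hx
    by_cases hJ : i ∈ J
    · rw [hx.1 hJ]; exact (hb i hJ).2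
    · exact (hx.2 hJ).2.2.1 hI
  let X : Set (ℕ → G) := {g | (∀ i, g i ∈ Y i) ∧ ∀ i, CoprimeOrders (g i) (g (i + 1))}
  have hXcl : IsClosed X := by
    have : X = (⋂ i, {g | g i ∈ Y i}) ∩ ⋂ i, {g | CoprimeOrders (g i) (g (i + 1))} := by
      ext g; simp [X]
    rw [this]
    exact (isClosed_iInter fun i => (hYcl i).preimage (continuous_apply i)).inter
      (isClosed_iInter fun i => (isClosed_setOf_coprimeOrders (G := G)).preimage
        (f := fun g : ℕ → G => (g i, g (i + 1))) (by fun_prop))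
  have hXA : X ⊆ coprimeSeqs A := fun g hg => ⟨fun i => hYA i _ (hg.1 i), hg.2⟩
  have hXne : X.Nonempty := by
    classical
    refine ⟨fun i => if i ∈ J then b i else 1, fun i => ?_, fun i => ?_⟩
    · by_cases hJ : i ∈ J
      · simp [Y, hJ]
      · simp [Y, hJ, supp_one, one_mem]
    · by_cases hJ : i ∈ J
      · by_cases hJ' : i + 1 ∈ J
        · simp only [hJ, hJ', if_true]
          exact (hπ i (hJI i hJ) (hJI _ hJ')).mono (hb i hJ).2 (hb _ hJ').2
        · simp [hJ', coprimeOrders_iff, supp_one]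
      · simp [hJ, coprimeOrders_iff, supp_one]
  obtain ⟨a, haX, O, hO, haO, hconst⟩ := exists_const_on_open hXcl.isCompact hXne
    (continuous_seqComm n) (lt_of_le_of_lt (Cardinal.mk_le_mk_of_subset (by
      rintro _ ⟨g, hg, rfl⟩
      exact (isDeltaStarValue_seqComm hcl hA hchain (hXA hg).1 (hXA hg).2 n).1)) hcard)
  obtain ⟨V₀, hV₀⟩ := exists_openNormalSubgroup_pi hO haO
  let V := V₀ ⊓ U
  have hVU : V ≤ U := inf_le_right
  have hσ : σ₀ ∪ indexPrimes U ⊆ σ₀ ∪ indexPrimes V :=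
    Set.union_subset_union_right _ (indexPrimes_anti hVU)
  -- replace the terms indexed by `I` by their parts supported on finitely many primes
  have htrunc : ∀ i, ∃ x ∈ closedPowers (a i), (i ∈ I → supp x ⊆ σ₀ ∪ indexPrimes V) ∧
      (i ∉ I → x = a i) ∧ (a i)⁻¹ * x ∈ V.toSubgroup := by
    intro i
    by_cases hI : i ∈ I
    · obtain ⟨p, hp, q, hq, he, hpσ, hqσ⟩ := exists_mul_eq_of_supp (σ₀ ∪ indexPrimes V) (a i)
      refine ⟨p, hp, fun _ => hpσ, fun h => absurd hI h, ?_⟩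
      rw [he, mul_inv_rev, inv_mul_cancel_right]
      exact inv_mem (mem_of_disjoint_indexPrimes (hqσ.mono_right Set.subset_union_right))
    · exact ⟨a i, self_mem_closedPowers _, fun h => absurd h hI, fun _ => rfl, by simp⟩
  choose a' ha'p ha'I ha'e ha'V using htrunc
  have ha's : ∀ i, supp (a' i) ⊆ supp (a i) := fun i => supp_subset_of_mem_closedPowers (ha'p i)
  have ha'X : a' ∈ X := by
    refine ⟨fun i => ⟨fun hJ => ?_, fun hJ => ?_⟩, fun i => (haX.2 i).mono (ha's _) (ha's _)⟩
    · rw [ha'e i (hJI i hJ)]; exact (haX.1 i).1 hJ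
    · obtain ⟨h1, h2, h3, h4⟩ := (haX.1 i).2 hJ
      exact ⟨closedPowers_le (hcl i) h1 (ha'p i), closedPowers_le hUcl h2 (ha'p i),
        fun hI => (ha's i).trans (h3 hI), fun hI => (ha's i).trans (h4 hI)⟩
  refine ⟨V, hVU, seqComm a' n, ⟨a', hXA ha'X, rfl⟩, fun τ hτ g hg => ?_⟩
  have ha'A : ∀ i, a' i ∈ A i := fun i => hYA i _ (ha'X.1 i)
  have ha'σ : ∀ i ∈ I, Disjoint (supp (a' i)) (σ₀ ∪ indexPrimes U) := fun i hI =>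
    Set.disjoint_right.2 fun p hp hp' => ((ha'X.1 i).2 fun hJ => hJI i hJ hI).2.2.2 hI hp' hp
  -- For `i ∈ I` the truncated supports lie in `σ₀ ∪ indexPrimes V`, which `τ i` avoids.
  have hτ' := hτ.union (s := fun i => supp (a' i)) hπσ Set.subset_union_left hσ ha'I ha'σ
    ha'X.2 fun i hI => hYπ i hI _ (ha'X.1 i)
  have hconst' : ∀ z ∈ X, (∀ i, (a' i)⁻¹ * z i ∈ V.toSubgroup) → seqComm z n = seqComm a' n := by
    have h1 : ∀ z ∈ X, (∀ i, (a i)⁻¹ * z i ∈ V.toSubgroup) → seqComm z n = seqComm a n :=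
      fun z hz h => hconst z ⟨hV₀ z fun i => (h i).1, hz⟩
    intro z hz h
    rw [h1 z hz fun i => by simpa [mul_assoc] using mul_mem (ha'V i) (h i), h1 a' ha'X ha'V]
  refine seqComm_mem_of_finalSet (A := fun i => hall (τ i ∪ supp (a' i)) (A i) (hA i))
    (P := fun i => hall (τ i) (A i) (hA i)) (U := U.toSubgroup) (V := V.toSubgroup) (J := J)
    (a := a') (hchain.hall hA _) (fun i => hall_mono Set.subset_union_left _)
    (fun i j hji y hy => hchain.conj_mem_hall hA τ i j hji y hy.1) hVU
    (fun i => ⟨ha'A i, Set.subset_union_right⟩) (fun i hJ => ((ha'X.1 i).2 hJ).2.1) n ?_ ?_ g ?_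
  · intro z hz
    classical
    -- Only the entries up to `n` are controlled; continuing by `a'` keeps the sequence in `X`.
    set z' : ℕ → G := fun i => if i ≤ n then z i else a' i with hz'
    have hz's : ∀ i, z' i ∈ startSet (fun i => hall (τ i) (A i) (hA i)) V.toSubgroup J a' i := by
      intro i
      by_cases hi : i ≤ n
      · simpa [hz', hi] using hz i hi
      · simp [hz', hi, startSet, one_mem]
    have hz'V : ∀ i, (a' i)⁻¹ * z' i ∈ V.toSubgroup ∧ (a' i)⁻¹ * z' i ∈ hall (τ i) (A i) (hA i) := by
      intro i
      by_cases hJ : i ∈ J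
      · rw [(hz's i).1 hJ, inv_mul_cancel]; exact ⟨one_mem _, one_mem _⟩
      · exact ((hz's i).2 hJ).symm
    have hsupp : ∀ i, supp (z' i) ⊆ τ i ∪ supp (a' i) := by
      intro i
      have := supp_mul_subset (hA i) (ha'A i) (hz'V i).2.1
      rw [mul_inv_cancel_left] at this
      rw [Set.union_comm]
      exact this.trans (Set.union_subset_union_right _ (hz'V i).2.2)
    have hz'X : z' ∈ X := by
      refine ⟨fun i => ⟨fun hJ => ?_, fun hJ => ⟨?_, ?_, fun hI => ?_, fun hI => ?_⟩⟩, fun i =>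
        (hτ'.disjoint i).mono (hsupp i) (hsupp (i + 1))⟩
      · rw [(hz's i).1 hJ]; exact (ha'X.1 i).1 hJ
      · simpa using mul_mem (ha'A i) (hz'V i).2.1
      · simpa using mul_mem ((ha'X.1 i).2 hJ).2.1 (hVU (hz'V i).1)
      · rw [← hτ'.eq i hI]; exact hsupp i
      · exact (hsupp i).trans (Set.subset_compl_iff_disjoint_right.2 (hτ'.avoids i hI))
    rw [seqComm_congr (g := z) (h := z') fun i hi => by simp [hz', hi],
      hconst' z' hz'X fun i => (hz'V i).1]
    exact subset_closedNormalClosure _ (Or.inr rfl)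
  · intro j hj z hz
    exact closedNormalClosure_mono Set.subset_union_left (hW _ hτ' j hj z hz)
  · intro i hi
    obtain ⟨h1, h2, h3⟩ := hg i hi
    refine ⟨h1, fun hJ => ?_, h3⟩
    rw [(ha'X.1 i).1 hJ]
    exact h2 hJ

/-- Induction on the set `J` of entries not confined to `U`. The sets `J \ {j}` give a common `U`;
the `J`-entries then meet finitely many families of cosets of `U`, each costing at most one more
commutator. -/
lemma exists_normalClosure_bigSet [TotallyDisconnectedSpace G]
    (hcl : ∀ i, IsClosed (A i : Set G)) (hA : ∀ i, IsPronilpotent (A i))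
    (hchain : NormalizingChain A) {n : ℕ}
    (hcard : Cardinal.mk {a : G // IsDeltaStarValue n a} < 2 ^ Cardinal.aleph0)
    {I : Set ℕ} {π : ℕ → Set ℕ} {σ₀ : Set ℕ} (hπσ : ∀ i, π i ⊆ σ₀)
    (hπ : ∀ i, i ∉ I → i + 1 ∉ I → Disjoint (π i) (π (i + 1))) (J : Finset ℕ)
    (hJI : ∀ i ∈ J, i ∉ I) (hJn : ∀ i ∈ J, i ≤ n) :
    ∃ (U : OpenNormalSubgroup G) (W : Set G), W.Finite ∧ W ⊆ (seqComm · n) '' coprimeSeqs A ∧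
      ∀ τ, IsPattern I π (σ₀ ∪ indexPrimes U) τ → ∀ g : ℕ → G,
        (∀ i ≤ n, g i ∈ bigSet (fun i => hall (τ i) (A i) (hA i)) U.toSubgroup J i) →
        seqComm g n ∈ closedNormalClosure W := by
  induction J using Finset.strongInduction with
  | H J ih =>
    have ih' : ∀ j : J, ∃ (U : OpenNormalSubgroup G) (W : Set G), W.Finite ∧
        W ⊆ (seqComm · n) '' coprimeSeqs A ∧
        ∀ τ, IsPattern I π (σ₀ ∪ indexPrimes U) τ → ∀ g : ℕ → G,
          (∀ i ≤ n, g i ∈ bigSet (fun i => hall (τ i) (A i) (hA i)) U.toSubgroup (J \ {(j : ℕ)}) i) →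
          seqComm g n ∈ closedNormalClosure W := by
      intro j
      have := ih (J.erase j) (Finset.erase_ssubset j.2)
        (fun i hi => hJI i (Finset.mem_of_mem_erase hi))
        (fun i hi => hJn i (Finset.mem_of_mem_erase hi))
      rwa [Finset.coe_erase] at this
    choose U₁ W₁ hW₁f hW₁ hUW₁ using ih'
    obtain ⟨U, hU⟩ := exists_le_forall U₁
    have hbig : ∀ τ, IsPattern I π (σ₀ ∪ indexPrimes U) τ → ∀ j ∈ (J : Set ℕ), ∀ g : ℕ → G,
        (∀ i ≤ n, g i ∈ bigSet (fun i => hall (τ i) (A i) (hA i)) U.toSubgroup (J \ {j}) i) →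
        seqComm g n ∈ closedNormalClosure (⋃ j, W₁ j) := by
      intro τ hτ j hj g hg
      refine closedNormalClosure_mono (Set.subset_iUnion W₁ ⟨j, hj⟩)
        (hUW₁ ⟨j, hj⟩ τ (hτ.anti ?_) g fun i hi => bigSet_mono_right (hU _) _ _ (hg i hi))
      exact Set.union_subset_union_right _ (indexPrimes_anti (hU _))
    have hcoset : ∀ c : J → G ⧸ U.toSubgroup, ∃ (V : OpenNormalSubgroup G) (W : Set G), V ≤ U ∧
        W.Finite ∧ W ⊆ (seqComm · n) '' coprimeSeqs A ∧
        ∀ τ, IsPattern I π (σ₀ ∪ indexPrimes V) τ → ∀ g : ℕ → G, (∀ i : J, g i = c i) →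
          (∀ i ≤ n, g i ∈ bigSet (fun i => hall (τ i) (A i) (hA i)) V.toSubgroup J i) →
          seqComm g n ∈ closedNormalClosure ((⋃ j, W₁ j) ∪ W) := by
      intro c
      by_cases hc : ∃ b : ℕ → G, ∀ i : J, b i ∈ hall (π i) (A i) (hA i) ∧ b i = c i
      · obtain ⟨b, hb⟩ := hc
        obtain ⟨V, hVU, w, hw, hV⟩ := exists_normalClosure_coset hcl hA hchain hcard hπσ hπ hJI U
          _ hbig b fun i hi => (hb ⟨i, hi⟩).1
        refine ⟨V, {w}, hVU, Set.finite_singleton w, by simpa using hw, fun τ hτ g hgc hg =>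
          hV τ hτ g fun i hi => ⟨(hg i hi).1, fun hJ => ?_, (hg i hi).2⟩⟩
        exact QuotientGroup.eq.1 ((hb ⟨i, hJ⟩).2.trans (hgc ⟨i, hJ⟩).symm)
      -- No admissible sequence meets these cosets, so nothing is needed.
      · refine ⟨U, ∅, le_rfl, Set.finite_empty, Set.empty_subset _, fun τ hτ g hgc hg =>
          absurd ⟨g, fun i => ⟨?_, hgc i⟩⟩ hc⟩
        rw [← hτ.eq i (hJI i i.2)]
        exact (hg i (hJn i i.2)).1
    choose V W hVU hWf hW hVW using hcoset
    obtain ⟨U', hU'⟩ := exists_le_forall V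
    refine ⟨U', (⋃ j, W₁ j) ∪ ⋃ c, W c, (Set.finite_iUnion hW₁f).union (Set.finite_iUnion hWf),
      Set.union_subset (Set.iUnion_subset hW₁) (Set.iUnion_subset hW), fun τ hτ g hg => ?_⟩
    let c : J → G ⧸ U.toSubgroup := fun i => g i
    refine closedNormalClosure_mono (Set.union_subset_union_right _ (Set.subset_iUnion W c))
      (hVW c τ (hτ.anti ?_) g (fun _ => rfl) fun i hi => bigSet_mono_right (hU' c) _ _ (hg i hi))
    exact Set.union_subset_union_right _ (indexPrimes_anti (hU' c))

end Patterns

/-! ### Passage from finite to infinite sequences -/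

section Extension

variable {G : Type u} [Group G] {n : ℕ}

/-- A finite sequence of subgroups, continued by trivial subgroups. -/
def extendBot (A : Fin (n + 1) → Subgroup G) (i : ℕ) : Subgroup G :=
  if h : i < n + 1 then A ⟨i, h⟩ else ⊥

lemma extendBot_coe (A : Fin (n + 1) → Subgroup G) (i : Fin (n + 1)) : extendBot A i = A i :=
  dif_pos i.2

lemma extendBot_of_lt (A : Fin (n + 1) → Subgroup G) {i : ℕ} (h : n < i) : extendBot A i = ⊥ :=
  dif_neg (by omega)

lemma extendBot_cases {A : Fin (n + 1) → Subgroup G} {p : Subgroup G → Prop} (h : ∀ i, p (A i))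
    (hbot : p ⊥) (i : ℕ) : p (extendBot A i) := by
  unfold extendBot
  split
  · exact h _
  · exact hbot

lemma normalizingChain_extendBot {A : Fin (n + 1) → Subgroup G}
    (h : ∀ i j, j ≤ i → A j ≤ Subgroup.normalizer (A i : Set G)) :
    NormalizingChain (extendBot A) := by
  intro i j hji a ha s hs
  rcases Nat.lt_or_ge n i with hi | hi
  · rw [extendBot_of_lt A hi, Subgroup.mem_bot] at hs ⊢
    simp [hs]
  · have ei := extendBot_coe A ⟨i, by omega⟩
    have ej := extendBot_coe A ⟨j, by omega⟩
    simp only at ei ej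
    rw [ej] at ha
    rw [ei] at hs ⊢
    exact (Subgroup.mem_normalizer_iff''.1 (h ⟨i, by omega⟩ ⟨j, by omega⟩ hji ha) s).1 hs

variable [TopologicalSpace G] [IsTopologicalGroup G]

lemma seqComm_mem_phiStar {S : Fin (n + 1) → Set G} {g : ℕ → G}
    (hg : ∀ i : Fin (n + 1), g i ∈ S i) (hcop : ∀ i < n, CoprimeOrders (g i) (g (i + 1))) :
    seqComm g n ∈ phiStar S :=
  ⟨fun i => g i, hg, fun i => hcop i i.2, (leftNormed_eq_seqComm n g).symm⟩

lemma exists_seq_of_mem_phiStar {A : Fin (n + 1) → Subgroup G} {x : G}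
    (hx : x ∈ phiStar fun i => (A i : Set G)) :
    ∃ g ∈ coprimeSeqs (extendBot A), x = seqComm g n := by
  obtain ⟨f, hf, hcop, rfl⟩ := hx
  -- The continuation by `1` has empty support, so the extra coprimality conditions hold.
  let g : ℕ → G := fun i => if h : i < n + 1 then f ⟨i, h⟩ else 1
  have hgf : ∀ i : Fin (n + 1), g i = f i := fun i => dif_pos i.2
  have hg1 : ∀ i, n < i → g i = 1 := fun i hi => dif_neg (by omega)
  refine ⟨g, ⟨fun i => ?_, fun i => ?_⟩, ?_⟩
  · rcases Nat.lt_or_ge n i with hi | hi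
    · rw [hg1 i hi]; exact one_mem _
    · have e1 := hgf ⟨i, by omega⟩
      have e2 := extendBot_coe A ⟨i, by omega⟩
      simp only at e1 e2
      rw [e1, e2]
      exact hf _
  · rcases Nat.lt_or_ge i n with hi | hi
    · have e1 := hgf (Fin.castSucc ⟨i, hi⟩)
      have e2 := hgf (Fin.succ ⟨i, hi⟩)
      simp only [Fin.val_castSucc, Fin.val_succ] at e1 e2
      rw [e1, e2]
      exact hcop ⟨i, hi⟩
    · rw [hg1 (i + 1) (by omega), coprimeOrders_iff, supp_one]
      exact Set.disjoint_empty _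
  · rw [← leftNormed_eq_seqComm]
    congr 1
    funext i
    exact (hgf i).symm

end Extension

/-! ### Splitting off the `σ`-parts -/

section Main

variable {G : Type u} [Group G] [TopologicalSpace G] [IsTopologicalGroup G] [CompactSpace G]

/-- The `σ`- and `σ'`-parts of an entry are powers of it, so they stay in its Hall `τ i`-subgroup
and the expansion applies. -/
lemma seqComm_mem_of_hall {A : ℕ → Subgroup G} (hcl : ∀ i, IsClosed (A i : Set G))
    (hA : ∀ i, IsPronilpotent (A i)) (hchain : NormalizingChain A) {n : ℕ} {I σ : Set ℕ}
    {M : Subgroup G} [M.Normal] {τ : ℕ → Set ℕ}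
    (hK : ∀ g : ℕ → G, (∀ i ≤ n, g i ∈ hall (τ i) (A i) (hA i)) →
      (∀ i ≤ n, i ∈ I → Disjoint (supp (g i)) σ) → seqComm g n ∈ M)
    (hX : ∀ j ∈ I, ∀ g : ℕ → G, (∀ i ≤ n, g i ∈ hall (τ i) (A i) (hA i)) →
      (j ≤ n → supp (g j) ⊆ σ) → seqComm g n ∈ M)
    {g : ℕ → G} (hg : ∀ i ≤ n, g i ∈ hall (τ i) (A i) (hA i)) : seqComm g n ∈ M := by
  refine seqComm_mem_of_factorization (I := I) (hchain.hall hA τ)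
    (K := fun i => {x | x ∈ hall (τ i) (A i) (hA i) ∧ (i ∈ I → Disjoint (supp x) σ)})
    (H := fun i => {x | x ∈ hall (τ i) (A i) (hA i) ∧ supp x ⊆ σ})
    (fun i x hx => hx.1) (fun i x hx => hx.1) (fun i _ x hx => ?_)
    (fun i hi x hx => ⟨hx, fun h => absurd h hi⟩) n
    (fun z hz => hK z (fun i hi => (hz i hi).1) fun i hi => (hz i hi).2) (fun j hj z hz => ?_) g hg
  · obtain ⟨a, ha, b, hb, he, haσ, hbσ⟩ := exists_mul_eq_of_supp σ x
    have mem : ∀ y ∈ closedPowers x, y ∈ hall (τ i) (A i) (hA i) := fun y hy =>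
      closedPowers_le (isClosed_hall (hA i) (hcl i)) hx hy
    exact ⟨a, ⟨mem a ha, haσ⟩, b, ⟨mem b hb, fun _ => hbσ⟩, he⟩
  · refine hX j hj z (fun i hi => ?_) fun hjn => ?_
    · have := hz i hi
      rcases eq_or_ne i j with rfl | hne
      · rw [Function.update_self] at this
        exact this.1
      · rwa [Function.update_of_ne hne] at this
    · have := hz j hjn
      rw [Function.update_self] at this
      exact this.2

theorem phiStar_subset_nSigma_mul [TotallyDisconnectedSpace G]
    (n : ℕ) (A : Fin (n + 1) → Subgroup G)
    (hclosed : ∀ i, IsClosed (A i : Set G))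
    (hpro : ∀ i, IsPronilpotent (A i))
    (hnorm : ∀ i j, j ≤ i → A j ≤ Subgroup.normalizer (A i : Set G))
    (hcard : Cardinal.mk {a : G // IsDeltaStarValue n a} < 2 ^ Cardinal.aleph0) :
    ∃ (W : Set G) (σ : Set ℕ),
      W.Finite ∧ W ⊆ phiStar (fun i => (A i : Set G)) ∧ σ.Finite ∧ (∀ p ∈ σ, p.Prime) ∧
      phiStar (fun i => (A i : Set G)) ⊆ (nSigma A σ : Set G) * (closedNormalClosure W : Set G) := by
  classical
  let B := extendBot A
  have hcl : ∀ i, IsClosed (B i : Set G) :=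
    extendBot_cases (A := A) (p := fun H : Subgroup G => IsClosed (H : Set G)) hclosed
      (isClosed_singleton (x := (1 : G)))
  have hB : ∀ i, IsPronilpotent (B i) :=
    extendBot_cases (A := A) (p := fun H : Subgroup G => IsPronilpotent H) hpro fun U => by infer_instance
  have hchain : NormalizingChain B := normalizingChain_extendBot hnorm
  have hΦ : (seqComm · n) '' coprimeSeqs B ⊆ phiStar (fun i => (A i : Set G)) := by
    rintro _ ⟨g, hg, rfl⟩
    exact seqComm_mem_phiStar (fun i => by rw [← extendBot_coe A i]; exact hg.1 i)
      fun i _ => hg.2 i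
  let I : Set ℕ := {i | (primesOf (B i)).Infinite}
  have hIn : ∀ i, n < i → i ∉ I := by
    intro i hi h
    refine h ?_
    have : B i = ⊥ := extendBot_of_lt A hi
    rw [this]
    refine Set.Finite.subset Set.finite_empty ?_
    rintro p ⟨hp, U, hU⟩
    rw [Subgroup.relIndex_bot_right] at hU
    exact absurd hU hp.not_dvd_one
  let σ₀ : Set ℕ := ⋃ i ∈ {i | i ≤ n ∧ i ∉ I}, primesOf (B i)
  have hσ₀ : σ₀.Finite := ((Set.finite_le_nat n).subset fun i hi => hi.1).biUnion
    fun i hi => Set.not_infinite.1 hi.2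
  have := hσ₀.to_subtype
  let π : (Fin (n + 1) → Set σ₀) → ℕ → Set ℕ := fun c i =>
    if h : i < n + 1 then Subtype.val '' c ⟨i, h⟩ else ∅
  have hπσ : ∀ c i, π c i ⊆ σ₀ := by
    intro c i
    simp only [π]
    split
    · rintro _ ⟨x, -, rfl⟩; exact x.2
    · exact Set.empty_subset _
  have hpat : ∀ c : Fin (n + 1) → Set σ₀, ∃ (U : OpenNormalSubgroup G) (W : Set G), W.Finite ∧
      W ⊆ (seqComm · n) '' coprimeSeqs B ∧
      ∀ τ, IsPattern I (π c) (σ₀ ∪ indexPrimes U) τ → ∀ g : ℕ → G,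
        (∀ i ≤ n, g i ∈ hall (τ i) (B i) (hB i)) → seqComm g n ∈ closedNormalClosure W := by
    intro c
    by_cases hc : ∀ i, i ∉ I → i + 1 ∉ I → Disjoint (π c i) (π c (i + 1))
    -- With `J` all indices up to `n` outside `I`, only entries at `I` must lie in `U`; they do,
    -- since their orders avoid the primes of `|G : U|`.
    · obtain ⟨U, W, hWf, hW, hUW⟩ := exists_normalClosure_bigSet hcl hB hchain hcard (hπσ c) hc
        ((Finset.range (n + 1)).filter (· ∉ I)) (fun i hi => (Finset.mem_filter.1 hi).2)
        fun i hi => Nat.lt_succ_iff.1 (Finset.mem_range.1 (Finset.mem_filter.1 hi).1)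
      refine ⟨U, W, hWf, hW, fun τ hτ g hg => hUW τ hτ g fun i hi => ⟨hg i hi, fun hJ => ?_⟩⟩
      have hI : i ∈ I := by
        by_contra hI
        exact hJ (by simpa [Nat.lt_succ_iff] using ⟨hi, hI⟩)
      exact mem_of_disjoint_indexPrimes ((hτ.avoids i hI).mono (hg i hi).2 Set.subset_union_right)
    · refine ⟨Classical.arbitrary _, ∅, Set.finite_empty, Set.empty_subset _, fun τ hτ => ?_⟩
      refine absurd (fun i hi hi' => ?_) hc
      rw [← hτ.eq i hi, ← hτ.eq _ hi']
      exact hτ.disjoint i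
  choose U W hWf hW hUW using hpat
  let σ : Set ℕ := ⋃ c, σ₀ ∪ indexPrimes (U c)
  refine ⟨⋃ c, W c, σ, Set.finite_iUnion hWf, (Set.iUnion_subset hW).trans hΦ,
    Set.finite_iUnion fun c => hσ₀.union (indexPrimes_finite _), fun p hp => ?_, fun x hx => ?_⟩
  · obtain ⟨c, hp | hp⟩ := Set.mem_iUnion.1 hp
    · obtain ⟨i, _, hp⟩ := Set.mem_iUnion₂.1 hp
      exact hp.1
    · exact hp.1
  have hN : (nSigma A σ).Normal := normal_closedNormalClosure _
  rw [← Subgroup.mul_normal]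
  obtain ⟨g, hg, rfl⟩ := exists_seq_of_mem_phiStar hx
  refine seqComm_mem_of_hall (I := I) (σ := σ) (τ := fun i => supp (g i)) hcl hB hchain
    (fun z hz hzI => ?_) (fun j hj z hz hzj => ?_) fun i _ => ⟨hg.1 i, le_rfl⟩
  · refine Subgroup.mem_sup_right ?_
    -- A pattern ignores `c` on `I`, so `∅` is a harmless default there.
    let c : Fin (n + 1) → Set σ₀ := fun i => if (i : ℕ) ∈ I then ∅ else {p | (p : ℕ) ∈ supp (g i)}
    refine closedNormalClosure_mono (Set.subset_iUnion W c)
      (hUW c (fun i => if i ∈ I then supp (g i) \ σ else supp (g i)) ⟨fun i hi => ?_,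
        fun i hi => ?_, fun i => (hg.2 i).mono ?_ ?_⟩ z fun i hi => ⟨(hz i hi).1, ?_⟩)
    · simp only [hi, if_false, π]
      split
      · rename_i h
        simp only [c, hi, if_false]
        ext p
        refine ⟨fun hp => ⟨⟨p, ?_⟩, hp, rfl⟩, fun ⟨q, hq, hqp⟩ => hqp ▸ hq⟩
        exact Set.mem_biUnion (show i ≤ n ∧ i ∉ I from ⟨by omega, hi⟩)
          (supp_subset_primesOf (hcl i) (hg.1 i) hp)
      · have h1 : g i ∈ B i := hg.1 i
        have h2 : B i = ⊥ := extendBot_of_lt A (by omega)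
        rw [h2, Subgroup.mem_bot] at h1
        rw [h1, supp_one]
    · simp only [hi, if_true]
      exact Set.disjoint_sdiff_left.mono_right (Set.subset_iUnion (fun c => σ₀ ∪ indexPrimes (U c)) c)
    · split
      · exact Set.sdiff_subset
      · exact le_rfl
    · split
      · exact Set.sdiff_subset
      · exact le_rfl
    · split
      · rename_i hI
        exact Set.subset_sdiff.2 ⟨(hz i hi).2, hzI i hi hI⟩
      · exact (hz i hi).2
  · refine Subgroup.mem_sup_left (subset_closedNormalClosure _ ?_)
    have hjn : j ≤ n := by
      by_contra h
      exact hIn j (by omega) hj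
    let j' : Fin (n + 1) := ⟨j, by omega⟩
    have hBj : B j = A j' := extendBot_coe A j'
    refine ⟨j', hall σ (A j') (hpro j'), by rw [← hBj]; exact hj, isHall_hall σ _ (hclosed j'),
      seqComm_mem_phiStar (fun i => ?_) fun i hi =>
        (hg.2 i).mono (hz i (by omega)).2 (hz (i + 1) (by omega)).2⟩
    have hi : z i ∈ A i := by
      rw [← extendBot_coe A i]
      exact (hz i (by omega)).1
    rcases eq_or_ne i j' with rfl | hne
    · rw [Function.update_self]
      exact ⟨hi, hzj hjn⟩
    · rw [Function.update_of_ne hne]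
      exact hi

end Main

end CoprimeCommutators

theorem mainTheorem6 {G : Type*} [Group G] [TopologicalSpace G] [IsTopologicalGroup G]
    [CompactSpace G] [TotallyDisconnectedSpace G]
    (n : ℕ) (A : Fin (n + 1) → Subgroup G)
    (hclosed : ∀ i, IsClosed (A i : Set G))
    (hpro : ∀ i, CoprimeCommutators.IsPronilpotent (A i))
    (hnorm : ∀ i j, j ≤ i → A j ≤ Subgroup.normalizer (A i : Set G))
    (hcard : Cardinal.mk {a : G // CoprimeCommutators.IsDeltaStarValue n a} <
      2 ^ Cardinal.aleph0) :
    ∃ (W : Set G) (σ : Set ℕ),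
      W.Finite ∧ W ⊆ CoprimeCommutators.phiStar (fun i => (A i : Set G)) ∧
      σ.Finite ∧ (∀ p ∈ σ, p.Prime) ∧
      CoprimeCommutators.phiStar (fun i => (A i : Set G)) ⊆
        (CoprimeCommutators.nSigma A σ : Set G) *
          (CoprimeCommutators.closedNormalClosure W : Set G) :=
  CoprimeCommutators.phiStar_subset_nSigma_mul n A hclosed hpro hnorm hcard
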